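/- Let $\lambda>0$, $\alpha>0$ and $\rho=\lambda\alpha$. Consider the $M|M|\infty$ queue: customers arrive according to a Poisson process of rate $\lambda$ (independent exponential interarrival times with parameter $\lambda$), the service times are exponential with mean $\alpha$, independent of each other and of the arrivals, and there are infinitely many servers, so that every service starts on arrival. The system is empty at time $0$. Let $I$ be the length of the initial idle period (the time until the first customer is present), $B$ the length of the busy period that follows it (the time from the end of the idle period until the system is next empty), and $Z=I+B$ the length of the busy cycle. Then for every $t\ge 0$: (i) if $2\rho\neq 1$, then $$P(Z\le t)\;\ge\;1-\frac{(\rho-1)e^{-\lambda t}+\rho\,e^{-\frac{1-\rho}{\alpha}t}}{2\rho-1};$$ (ii) if $\rho(1+e^{-\rho})\neq 1$, then $$P(Z\le t)\;\le\;1-\frac{(\rho-1)e^{-\lambda t}+\rho\,e^{-\rho-\frac{1-\rho e^{-\rho}}{\alpha}t}}{\rho(1+e^{-\rho})-1}.$$ -/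

import Mathlib

open MeasureTheory ProbabilityTheory

namespace MMInfQueue

/-- `A` and `S` are the interarrival times and the service times of an `M|M|∞` queue that is empty
at time `0`, with Poisson arrivals of rate `lam` and exponential service times of mean `α`:
all interarrival times `A 0, A 1, …` and all service times `S 0, S 1, …` are mutually independent,
the former exponential with rate `lam`, the latter exponential with rate `α⁻¹`.
The first customer arrives at time `A 0`. -/
structure IsQueue {Ω : Type*} [MeasurableSpace Ω] (P : Measure Ω) (lam α : ℝ)
    (A S : ℕ → Ω → ℝ) : Prop where
  hasLaw_interarrival : ∀ n, HasLaw (A n) (expMeasure lam) P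
  hasLaw_service : ∀ n, HasLaw (S n) (expMeasure α⁻¹) P
  indep : iIndepFun (Sum.elim A S) P

/-- The arrival instant of customer `n` (the customers are numbered from `0`). -/
def arrivalTime (a : ℕ → ℝ) (n : ℕ) : ℝ := ∑ i ∈ Finset.range (n + 1), a i

/-- The customers present at time `t`. With infinitely many servers, the service of every customer
starts on arrival, so customer `n` is present from `arrivalTime a n` (included) to
`arrivalTime a n + s n` (excluded). -/
def present (a s : ℕ → ℝ) (t : ℝ) : Set ℕ :=
  {n | arrivalTime a n ≤ t ∧ t < arrivalTime a n + s n}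

/-- The number of customers in the system (that is, of busy servers) at time `t`. -/
noncomputable def numInSystem (a s : ℕ → ℝ) (t : ℝ) : ℕ∞ := (present a s t).encard

/-- The length of the initial idle period: the first time at which the system is not empty. -/
noncomputable def idlePeriod (a s : ℕ → ℝ) : ℝ :=
  sInf {t : ℝ | 0 ≤ t ∧ numInSystem a s t ≠ 0}

/-- The length of the busy period that follows the initial idle period: the time that elapses from
the end of the idle period until the system is empty (`⊤` if this never happens). -/
noncomputable def busyPeriod (a s : ℕ → ℝ) : EReal :=
  ⨅ u ∈ {u : ℝ | 0 ≤ u ∧ numInSystem a s (idlePeriod a s + u) = 0}, (u : EReal)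

/-- The length of the busy cycle: an idle period followed by a busy period. -/
noncomputable def busyCycle (a s : ℕ → ℝ) : EReal := (idlePeriod a s : EReal) + busyPeriod a s

end MMInfQueue

/-!
Let `S` be a service time. While the busy cycle lasts, customers arrive at rate `lam`, so the mean
number of customers of the first cycle that are present at time `t` is
`lam * ∫ u in 0..t, P(Z > u) * P(S > t - u)`. The cycle is unfinished at time `t` if and only if the
first arrival is still to come or such a customer is present. A union bound over these customers
bounds `P(Z > t)` from above by `exp (-lam * t)` plus this integral. Counting only the customer that
arrived last among those present makes the events disjoint, and costs at most a factor `exp (-ρ)`: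
customers arriving after a given one form a fresh queue, which is empty at any time with probability
at least `exp (-ρ)`. Hence `P(Z > t)` is a sub- and a supersolution of two linear Volterra equations
whose solutions are explicit combinations of exponentials.
-/

namespace MMInfQueue

open Set Filter Topology
open scoped ENNReal

section ProductMeasure

variable {ι κ X : Type*} [MeasurableSpace X]

instance isProbabilityMeasure_sumElim (μ : ι → Measure X) (ν : κ → Measure X)
    [∀ i, IsProbabilityMeasure (μ i)] [∀ k, IsProbabilityMeasure (ν k)] (j : ι ⊕ κ) :
    IsProbabilityMeasure (Sum.elim μ ν j) := by
  cases j <;> simp only [Sum.elim_inl, Sum.elim_inr] <;> infer_instance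

lemma measurePreserving_infinitePi_comp (μ : κ → Measure X) [∀ k, IsProbabilityMeasure (μ k)]
    {f : ι → κ} (hf : f.Injective) :
    MeasurePreserving (fun (x : κ → X) i ↦ x (f i)) (Measure.infinitePi μ)
      (Measure.infinitePi fun i ↦ μ (f i)) := by
  have hindep : iIndepFun (fun i (x : κ → X) ↦ x (f i)) (Measure.infinitePi μ) :=
    (iIndepFun_infinitePi (P := μ) (X := fun _ x ↦ x) fun _ ↦ measurable_id).precomp hf
  have hlaw (i : ι) : HasLaw (fun x : κ → X ↦ x (f i)) (μ (f i)) (Measure.infinitePi μ) :=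
    (measurePreserving_eval_infinitePi μ (f i)).hasLaw
  have hmeas : Measurable fun (x : κ → X) i ↦ x (f i) := by fun_prop
  exact ⟨hmeas, (hindep.hasLaw_infinitePi hlaw hmeas.aemeasurable).map_eq⟩

lemma measurePreserving_sumElim (μ : ι → Measure X) (ν : κ → Measure X)
    [∀ i, IsProbabilityMeasure (μ i)] [∀ k, IsProbabilityMeasure (ν k)] :
    MeasurePreserving (fun p : (ι → X) × (κ → X) ↦ Sum.elim p.1 p.2)
      ((Measure.infinitePi μ).prod (Measure.infinitePi ν))
      (Measure.infinitePi (Sum.elim μ ν)) := by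
  have hmeas : Measurable fun p : (ι → X) × (κ → X) ↦ Sum.elim p.1 p.2 := by
    refine measurable_pi_lambda _ fun j ↦ ?_
    cases j <;> simp only [Sum.elim_inl, Sum.elim_inr] <;> fun_prop
  refine ⟨hmeas, Measure.eq_infinitePi _ fun s t ht ↦ ?_⟩
  have hbox : (fun p : (ι → X) × (κ → X) ↦ Sum.elim p.1 p.2) ⁻¹' Set.pi s t
      = Set.pi s.toLeft (fun i ↦ t (.inl i)) ×ˢ Set.pi s.toRight (fun k ↦ t (.inr k)) := by
    ext p
    simp [Set.mem_pi]
  rw [Measure.map_apply hmeas (.pi s.countable_toSet fun j _ ↦ ht j), hbox, Measure.prod_prod,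
    Measure.infinitePi_pi _ fun i _ ↦ ht _, Measure.infinitePi_pi _ fun k _ ↦ ht _,
    Finset.prod_sum_eq_prod_toLeft_mul_prod_toRight]
  simp only [Sum.elim_inl, Sum.elim_inr]

variable (μ : ι → Measure X) [∀ i, IsProbabilityMeasure (μ i)]

lemma lintegral_infinitePi_resample {f : ι → ι ⊕ ι} (hf : f.Injective)
    (hμ : ∀ i, Sum.elim μ μ (f i) = μ i) {Φ : (ι → X) → ℝ≥0∞} (hΦ : Measurable Φ) :
    ∫⁻ x, Φ x ∂Measure.infinitePi μ
      = ∫⁻ x, ∫⁻ y, Φ (fun i ↦ Sum.elim x y (f i)) ∂Measure.infinitePi μ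
          ∂Measure.infinitePi μ := by
  have hmix : MeasurePreserving (fun (p : (ι → X) × (ι → X)) i ↦ Sum.elim p.1 p.2 (f i))
      ((Measure.infinitePi μ).prod (Measure.infinitePi μ)) (Measure.infinitePi μ) := by
    have h := (measurePreserving_infinitePi_comp (Sum.elim μ μ) hf).comp
      (measurePreserving_sumElim μ μ)
    simp only [hμ] at h
    exact h
  rw [← hmix.lintegral_comp hΦ]
  exact lintegral_prod _ (hΦ.comp hmix.measurable).aemeasurable

lemma lintegral_infinitePi_update [DecidableEq ι] (i : ι) {Φ : (ι → X) → ℝ≥0∞}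
    (hΦ : Measurable Φ) :
    ∫⁻ x, Φ x ∂Measure.infinitePi μ
      = ∫⁻ x, ∫⁻ y, Φ (Function.update x i y) ∂μ i ∂Measure.infinitePi μ := by
  let f (j : ι) : ι ⊕ ι := if j = i then .inr i else .inl j
  have hf : f.Injective := by
    intro j k hjk
    simp only [f] at hjk
    grind
  have hμ (j : ι) : Sum.elim μ μ (f j) = μ j := by
    simp only [f]
    split_ifs with h <;> simp [h]
  have hupdate (x y : ι → X) : (fun j ↦ Sum.elim x y (f j)) = Function.update x i (y i) := by
    ext j
    by_cases h : j = i <;> simp [f, h]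
  rw [lintegral_infinitePi_resample μ hf hμ hΦ]
  refine lintegral_congr fun x ↦ ?_
  simp only [hupdate]
  exact (measurePreserving_eval_infinitePi μ i).lintegral_comp (hΦ.comp (measurable_update x))

end ProductMeasure

lemma setLIntegral_Icc_ofReal {f : ℝ → ℝ} {t : ℝ} (ht : 0 ≤ t)
    (hf : IntervalIntegrable f volume 0 t) (h0 : ∀ u ∈ Icc 0 t, 0 ≤ f u) :
    ∫⁻ u in Icc 0 t, ENNReal.ofReal (f u) = ENNReal.ofReal (∫ u in 0..t, f u) := by
  rw [intervalIntegral.integral_of_le ht, ← integral_Icc_eq_integral_Ioc,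
    ofReal_integral_eq_lintegral_ofReal]
  · exact (integrableOn_Icc_iff_integrableOn_Ioc (by simp)).2 <|
      (intervalIntegrable_iff_integrableOn_Ioc_of_le ht).1 hf
  · exact (ae_restrict_iff' measurableSet_Icc).2 (.of_forall h0)

section Exponential

variable {r : ℝ}

lemma expMeasure_Ioi (hr : 0 < r) {v : ℝ} (hv : 0 ≤ v) :
    expMeasure r (Ioi v) = ENNReal.ofReal (Real.exp (-(r * v))) := by
  have := isProbabilityMeasure_expMeasure hr
  rw [← compl_Iic, prob_compl_eq_one_sub measurableSet_Iic, ← ofReal_cdf, cdf_expMeasure_eq hr,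
    if_pos hv, ← ENNReal.ofReal_one, ← ENNReal.ofReal_sub _ (by simpa using by positivity),
    sub_sub_cancel]

lemma expMeasure_Iic_zero (hr : 0 < r) : expMeasure r (Iic 0) = 0 := by
  have := isProbabilityMeasure_expMeasure hr
  rw [← ofReal_cdf, cdf_expMeasure_eq hr, if_pos le_rfl]
  simp

lemma lintegral_expMeasure_add (hr : 0 < r) (τ : ℝ) {f : ℝ → ℝ≥0∞} (hf : Measurable f) :
    ∫⁻ a, f (τ + a) ∂expMeasure r
      = ∫⁻ u, ENNReal.ofReal r * f u * expMeasure r {a | τ ≤ u ∧ u < τ + a} := by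
  have hpdf : Measurable (exponentialPDF r) := (measurable_exponentialPDFReal r).ennreal_ofReal
  calc ∫⁻ a, f (τ + a) ∂expMeasure r
      = ∫⁻ a, exponentialPDF r a * f (τ + a) :=
        lintegral_withDensity_eq_lintegral_mul _ hpdf (by fun_prop)
    _ = ∫⁻ a, ENNReal.ofReal r * f (τ + a) * expMeasure r {b | τ ≤ τ + a ∧ τ + a < τ + b} := by
        refine lintegral_congr fun a ↦ ?_
        rcases lt_or_ge a 0 with ha | ha
        · simp [exponentialPDF_of_neg ha, ha.not_ge]
        · have : {b : ℝ | τ ≤ τ + a ∧ τ + a < τ + b} = Ioi a := by ext b; simp [ha]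
          rw [exponentialPDF_of_nonneg ha, this, expMeasure_Ioi hr ha, ENNReal.ofReal_mul hr.le]
          ring
    _ = _ := lintegral_add_left_eq_self (μ := volume)
        (fun u ↦ ENNReal.ofReal r * f u * expMeasure r {a | τ ≤ u ∧ u < τ + a}) τ

lemma setLIntegral_Iic_expMeasure {c : ℝ} {f : ℝ → ℝ≥0∞} (hf : Measurable f) :
    ∫⁻ a in Iic c, f a ∂expMeasure r
      = ∫⁻ a in Icc 0 c, ENNReal.ofReal (r * Real.exp (-(r * a))) * f a := by
  have hpdf : Measurable (exponentialPDF r) := (measurable_exponentialPDFReal r).ennreal_ofReal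
  calc ∫⁻ a in Iic c, f a ∂expMeasure r
      = ∫⁻ a in Iic c, exponentialPDF r a * f a :=
        setLIntegral_withDensity_eq_setLIntegral_mul _ hpdf hf measurableSet_Iic
    _ = _ := by
        rw [← lintegral_indicator measurableSet_Iic, ← lintegral_indicator measurableSet_Icc]
        refine lintegral_congr fun a ↦ ?_
        by_cases ha : 0 ≤ a
        · simp [indicator, ha, exponentialPDF_of_nonneg]
        · simp [indicator, ha, exponentialPDF_of_neg (not_le.1 ha)]

end Exponential

section Paths

variable {a s : ℕ → ℝ}

/-- The arrival instant of the customer preceding customer `n`, or `0` if `n = 0`. -/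
def prevArrivalTime (a : ℕ → ℝ) (n : ℕ) : ℝ := ∑ i ∈ Finset.range n, a i

@[simp] lemma arrivalTime_zero : arrivalTime a 0 = a 0 := by simp [arrivalTime]

lemma arrivalTime_eq_prevArrivalTime_add (n : ℕ) :
    arrivalTime a n = prevArrivalTime a n + a n :=
  Finset.sum_range_succ a n

lemma arrivalTime_succ (n : ℕ) : arrivalTime a (n + 1) = arrivalTime a n + a (n + 1) :=
  Finset.sum_range_succ a (n + 1)

lemma arrivalTime_strictMono (ha : ∀ n, 0 < a n) : StrictMono (arrivalTime a) :=
  strictMono_nat_of_lt_succ fun n ↦ by rw [arrivalTime_succ]; linarith [ha (n + 1)]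

lemma le_arrivalTime (ha : ∀ n, 0 < a n) (n : ℕ) : a 0 ≤ arrivalTime a n := by
  simpa using (arrivalTime_strictMono ha).monotone n.zero_le

lemma prevArrivalTime_nonneg (ha : ∀ n, 0 < a n) (n : ℕ) : 0 ≤ prevArrivalTime a n :=
  Finset.sum_nonneg fun i _ ↦ (ha i).le

lemma exists_lt_arrivalTime_of_frequently (ha : ∀ n, 0 < a n) {c : ℝ} (hc : 0 < c)
    (hfreq : ∃ᶠ n in atTop, c < a n) (u : ℝ) : ∃ n, u < arrivalTime a n := by
  by_contra! hle
  have hsum : Summable a := by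
    refine summable_of_sum_range_le (c := u) (fun n ↦ (ha n).le) fun n ↦ ?_
    exact (Finset.sum_le_sum_of_subset_of_nonneg (Finset.range_mono n.le_succ)
      fun i _ _ ↦ (ha i).le).trans (hle n)
  exact hfreq ((hsum.tendsto_atTop_zero.eventually_lt_const hc).mono fun n hn ↦ hn.not_gt)

/-- Customer `k` does not break the busy period by arriving at time `u`: either `k` is the first
customer, or one of the previous ones leaves no earlier than `u`. -/
def Sustained (a s : ℕ → ℝ) (k : ℕ) (u : ℝ) : Prop :=
  k = 0 ∨ ∃ j < k, u ≤ arrivalTime a j + s j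

/-- Customer `n` arrives during the first busy cycle. The comparison in `Sustained` is weak: a
customer who arrives at the very moment of the last departure finds an empty system, but at no
time is `present` empty. -/
def InFirstCycle (a s : ℕ → ℝ) (n : ℕ) : Prop :=
  ∀ k ≤ n, Sustained a s k (arrivalTime a k)

/-- Customer `n` would belong to the first busy cycle if he arrived at time `u`. -/
def ContinuesCycle (a s : ℕ → ℝ) (n : ℕ) (u : ℝ) : Prop :=
  (∀ k < n, Sustained a s k (arrivalTime a k)) ∧ Sustained a s n u

/-- The busy cycle is not over at time `t`: either no customer has arrived, or some customer of the
first cycle is present. -/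
def Unfinished (a s : ℕ → ℝ) (t : ℝ) : Prop :=
  t < a 0 ∨ ∃ n, InFirstCycle a s n ∧ n ∈ present a s t

lemma inFirstCycle_iff_continuesCycle {n : ℕ} :
    InFirstCycle a s n ↔ ContinuesCycle a s n (arrivalTime a n) :=
  ⟨fun h ↦ ⟨fun k hk ↦ h k hk.le, h n le_rfl⟩,
    fun h k hk ↦ hk.lt_or_eq.elim (h.1 k) fun hkn ↦ hkn ▸ h.2⟩

lemma lt_of_mem_present (ha : ∀ n, 0 < a n) {j k : ℕ} {r : ℝ} (hj : j ∈ present a s r)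
    (hr : r < arrivalTime a k) : j < k :=
  (arrivalTime_strictMono ha).lt_iff_lt.1 (hj.1.trans_lt hr)

lemma InFirstCycle.present_nonempty (ha : ∀ n, 0 < a n) {n : ℕ} {r t : ℝ}
    (hn : InFirstCycle a s n) (ht : n ∈ present a s t) (hr : a 0 ≤ r) (hrt : r ≤ t) :
    (present a s r).Nonempty := by
  by_cases hnr : arrivalTime a n ≤ r
  · exact ⟨n, hnr, hrt.trans_lt ht.2⟩
  obtain ⟨k, hk, hk'⟩ := Nat.exists_not_and_succ_of_not_zero_of_exists
    (p := fun k ↦ r < arrivalTime a k) (by simpa using hr) ⟨n, not_le.1 hnr⟩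
  have hT := arrivalTime_strictMono ha
  have hkn : k + 1 ≤ n := hT.lt_iff_lt.1 ((not_lt.1 hk).trans_lt (not_le.1 hnr))
  obtain ⟨j, hj, hjk⟩ := (hn (k + 1) hkn).resolve_left k.succ_ne_zero
  exact ⟨j, (hT.monotone (Nat.lt_succ_iff.1 hj)).trans (not_lt.1 hk), hk'.trans_le hjk⟩

lemma exists_present_eq_empty_of_not_sustained (ha : ∀ n, 0 < a n) {k : ℕ}
    (hk : ¬ Sustained a s k (arrivalTime a k)) :
    ∃ r, a 0 ≤ r ∧ r < arrivalTime a k ∧ present a s r = ∅ := by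
  obtain ⟨hk0, hleft⟩ := not_or.1 hk
  push Not at hleft
  obtain ⟨m, rfl⟩ := Nat.exists_eq_succ_of_ne_zero hk0
  obtain ⟨j₀, hj₀, hmax⟩ := (Finset.range (m + 1)).exists_max_image
    (fun j ↦ arrivalTime a j + s j) ⟨0, by simp⟩
  refine ⟨max (arrivalTime a m) (arrivalTime a j₀ + s j₀),
    (le_arrivalTime ha m).trans (le_max_left _ _), max_lt ?_ ?_, ?_⟩
  · exact arrivalTime_strictMono ha m.lt_succ_self
  · exact hleft j₀ (Finset.mem_range.1 hj₀)
  · refine eq_empty_of_forall_notMem fun j hj ↦ ?_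
    have hjm : j < m + 1 := lt_of_mem_present ha hj
      (max_lt (arrivalTime_strictMono ha m.lt_succ_self) (hleft j₀ (Finset.mem_range.1 hj₀)))
    exact absurd hj.2 (not_lt.2 (le_max_of_le_right (hmax j (Finset.mem_range.2 hjm))))

lemma unfinished_iff_forall (ha : ∀ n, 0 < a n) {t : ℝ} :
    Unfinished a s t ↔ ∀ r, a 0 ≤ r → r ≤ t → (present a s r).Nonempty := by
  constructor
  · rintro (h | ⟨n, hn, ht⟩) r hr hrt
    · linarith
    · exact hn.present_nonempty ha ht hr hrt
  · intro h
    refine or_iff_not_imp_left.2 fun ht ↦ ?_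
    obtain ⟨n, hn⟩ := h t (not_lt.1 ht) le_rfl
    refine ⟨n, fun k hk ↦ ?_, hn⟩
    by_contra hcon
    obtain ⟨r, hr, hrk, hempty⟩ := exists_present_eq_empty_of_not_sustained ha hcon
    have hrt : r ≤ t := hrk.le.trans (((arrivalTime_strictMono ha).monotone hk).trans hn.1)
    exact (h r hr hrt).ne_empty hempty

lemma numInSystem_eq_zero {t : ℝ} : numInSystem a s t = 0 ↔ present a s t = ∅ := encard_eq_zero

lemma idlePeriod_eq (ha : ∀ n, 0 < a n) (hs : 0 < s 0) : idlePeriod a s = a 0 := by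
  have h : IsLeast {t : ℝ | 0 ≤ t ∧ numInSystem a s t ≠ 0} (a 0) := by
    refine ⟨⟨(ha 0).le, fun h ↦ ?_⟩, fun t ht ↦ ?_⟩
    · have h0 : 0 ∈ present a s (a 0) := ⟨by simp, by simpa using hs⟩
      exact notMem_empty 0 (numInSystem_eq_zero.1 h ▸ h0)
    · obtain ⟨n, hn⟩ := nonempty_iff_ne_empty.2 (mt numInSystem_eq_zero.2 ht.2)
      exact (le_arrivalTime ha n).trans hn.1
  exact h.csInf_eq

lemma busyCycle_eq (ha : ∀ n, 0 < a n) (hs : 0 < s 0) :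
    busyCycle a s
      = (a 0 : EReal) + ⨅ u ∈ {u : ℝ | 0 ≤ u ∧ present a s (a 0 + u) = ∅}, (u : EReal) := by
  simp only [busyCycle, busyPeriod, idlePeriod_eq ha hs, numInSystem_eq_zero]

lemma busyCycle_le_of_present_eq_empty (ha : ∀ n, 0 < a n) (hs : 0 < s 0) {r : ℝ} (hr : a 0 ≤ r)
    (hempty : present a s r = ∅) : busyCycle a s ≤ r := by
  have hmem : r - a 0 ∈ {u : ℝ | 0 ≤ u ∧ present a s (a 0 + u) = ∅} := by
    simpa [hr] using hempty
  calc busyCycle a s ≤ (a 0 : EReal) + ((r - a 0 : ℝ) : EReal) := by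
        rw [busyCycle_eq ha hs]
        gcongr
        exact iInf₂_le _ hmem
    _ = r := by rw [← EReal.coe_add, add_sub_cancel]

lemma lt_busyCycle (ha : ∀ n, 0 < a n) (hs : 0 < s 0) {t : ℝ}
    (h : ∀ r, a 0 ≤ r → r ≤ t → (present a s r).Nonempty) : t < busyCycle a s := by
  obtain ⟨v, htv, hv⟩ : ∃ v, t < v ∧
      ∀ r, a 0 ≤ r → r < v → (present a s r).Nonempty := by
    rcases lt_or_ge t (a 0) with ht | ht
    · exact ⟨a 0, ht, fun r hr hr' ↦ absurd hr' hr.not_gt⟩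
    · obtain ⟨n, hn⟩ := h t ht le_rfl
      refine ⟨arrivalTime a n + s n, hn.2, fun r hr hrv ↦ ?_⟩
      rcases le_or_gt r t with hrt | hrt
      · exact h r hr hrt
      · exact ⟨n, hn.1.trans hrt.le, hrv⟩
  calc (t : EReal) < v := EReal.coe_lt_coe_iff.2 htv
    _ = (a 0 : EReal) + ((v - a 0 : ℝ) : EReal) := by rw [← EReal.coe_add, add_sub_cancel]
    _ ≤ busyCycle a s := by
      rw [busyCycle_eq ha hs]
      gcongr
      refine le_iInf₂ fun u hu ↦ EReal.coe_le_coe_iff.2 ?_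
      by_contra! hlt
      exact (hv (a 0 + u) (by linarith [hu.1]) (by linarith)).ne_empty hu.2

lemma busyCycle_le_iff (ha : ∀ n, 0 < a n) (hs : 0 < s 0) {t : ℝ} :
    busyCycle a s ≤ t ↔ ¬ Unfinished a s t := by
  rw [unfinished_iff_forall ha]
  refine ⟨fun h hne ↦ (lt_busyCycle ha hs hne).not_ge h, fun h ↦ ?_⟩
  push Not at h
  obtain ⟨r, hr, hrt, hempty⟩ := h
  exact (busyCycle_le_of_present_eq_empty ha hs hr hempty).trans (EReal.coe_le_coe_iff.2 hrt)

/-- At time `u` the first cycle is not over (unless it ends at `u`), and customer `n` is the next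
to arrive. -/
def AwaitsArrival (a s : ℕ → ℝ) (n : ℕ) (u : ℝ) : Prop :=
  ContinuesCycle a s n u ∧ prevArrivalTime a n ≤ u ∧ u < arrivalTime a n

lemma AwaitsArrival.eq (ha : ∀ n, 0 < a n) {m n : ℕ} {u : ℝ} (hm : AwaitsArrival a s m u)
    (hn : AwaitsArrival a s n u) : m = n := by
  have hle {m n : ℕ} (hm : AwaitsArrival a s m u) (hn : AwaitsArrival a s n u) : m ≤ n := by
    by_contra! hlt
    obtain ⟨m, rfl⟩ := Nat.exists_eq_succ_of_ne_zero (Nat.ne_zero_of_lt hlt)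
    have := (arrivalTime_strictMono ha).monotone (Nat.lt_succ_iff.1 hlt)
    exact absurd (this.trans hm.2.1) (not_le.2 hn.2.2)
  exact (hle hm hn).antisymm (hle hn hm)

lemma unfinished_of_awaitsArrival (ha : ∀ n, 0 < a n) {n : ℕ} {u : ℝ}
    (hdep : ∀ j, u ≠ arrivalTime a j + s j) (h : AwaitsArrival a s n u) : Unfinished a s u := by
  obtain ⟨⟨hcycle, rfl | ⟨j, hj, hju⟩⟩, hprev, hnext⟩ := h
  · exact .inl (by simpa using hnext)
  obtain ⟨m, rfl⟩ := Nat.exists_eq_succ_of_ne_zero (Nat.ne_zero_of_lt hj)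
  have hjm := (arrivalTime_strictMono ha).monotone (Nat.lt_succ_iff.1 hj)
  exact .inr ⟨j, fun k hk ↦ hcycle k (hk.trans_lt hj), hjm.trans hprev, hju.lt_of_ne (hdep j)⟩

lemma exists_awaitsArrival_of_unfinished (ha : ∀ n, 0 < a n) {u : ℝ} (hu : 0 ≤ u)
    (hub : ∃ n, u < arrivalTime a n) (h : Unfinished a s u) : ∃ n, AwaitsArrival a s n u := by
  have hT := arrivalTime_strictMono ha
  obtain ⟨n, hprev, hnext⟩ := Nat.exists_not_and_succ_of_not_zero_of_exists
    (p := fun n ↦ u < prevArrivalTime a n) (by simpa [prevArrivalTime] using hu)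
    (hub.imp' (· + 1) fun _ ↦ id)
  have harrived {k : ℕ} (hk : k < n) : arrivalTime a k ≤ u := by
    obtain ⟨m, rfl⟩ := Nat.exists_eq_succ_of_ne_zero (Nat.ne_zero_of_lt hk)
    exact (hT.monotone (Nat.lt_succ_iff.1 hk)).trans (not_lt.1 hprev)
  refine ⟨n, ?_, not_lt.1 hprev, hnext⟩
  rcases h with h0 | ⟨m, hm, hmu⟩
  · obtain rfl : n = 0 := by
      by_contra hn
      exact absurd (harrived (Nat.pos_of_ne_zero hn)) (by simpa using h0)
    exact ⟨fun k hk ↦ absurd hk k.not_lt_zero, .inl rfl⟩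
  · refine ⟨fun k hk ↦ ?_, .inr ⟨m, lt_of_mem_present ha hmu hnext, hmu.2.le⟩⟩
    rcases le_or_gt k m with hkm | hmk
    · exact hm k hkm
    · exact .inr ⟨m, hmk, (harrived hk).trans hmu.2.le⟩

lemma unfinished_iff_exists_awaitsArrival (ha : ∀ n, 0 < a n) {u : ℝ} (hu : 0 ≤ u)
    (hub : ∃ n, u < arrivalTime a n) (hdep : ∀ j, u ≠ arrivalTime a j + s j) :
    Unfinished a s u ↔ ∃ n, AwaitsArrival a s n u :=
  ⟨exists_awaitsArrival_of_unfinished ha hu hub,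
    fun ⟨_, hn⟩ ↦ unfinished_of_awaitsArrival ha hdep hn⟩

lemma arrivalTime_congr {a' : ℕ → ℝ} {n : ℕ} (h : ∀ i ≤ n, a i = a' i) :
    arrivalTime a n = arrivalTime a' n :=
  Finset.sum_congr rfl fun i hi ↦ h i (by simpa [Nat.lt_succ_iff] using hi)

lemma prevArrivalTime_congr {a' : ℕ → ℝ} {n : ℕ} (h : ∀ i < n, a i = a' i) :
    prevArrivalTime a n = prevArrivalTime a' n :=
  Finset.sum_congr rfl fun i hi ↦ h i (Finset.mem_range.1 hi)

lemma sustained_congr {a' s' : ℕ → ℝ} {k : ℕ} {u : ℝ} (ha : ∀ i < k, a i = a' i)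
    (hs : ∀ i < k, s i = s' i) : Sustained a s k u ↔ Sustained a' s' k u := by
  refine or_congr_right (exists_congr fun j ↦ and_congr_right fun hj ↦ ?_)
  rw [arrivalTime_congr fun i hi ↦ ha i (hi.trans_lt hj), hs j hj]

lemma continuesCycle_congr {a' s' : ℕ → ℝ} {n : ℕ} {u : ℝ} (ha : ∀ i < n, a i = a' i)
    (hs : ∀ i < n, s i = s' i) : ContinuesCycle a s n u ↔ ContinuesCycle a' s' n u := by
  refine and_congr (forall₂_congr fun k hk ↦ ?_) (sustained_congr ha hs)
  rw [arrivalTime_congr fun i hi ↦ ha i (hi.trans_lt hk),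
    sustained_congr (fun i hi ↦ ha i (hi.trans hk)) fun i hi ↦ hs i (hi.trans hk)]

lemma inFirstCycle_congr {a' s' : ℕ → ℝ} {n : ℕ} (ha : ∀ i ≤ n, a i = a' i)
    (hs : ∀ i < n, s i = s' i) : InFirstCycle a s n ↔ InFirstCycle a' s' n := by
  rw [inFirstCycle_iff_continuesCycle, inFirstCycle_iff_continuesCycle, arrivalTime_congr ha,
    continuesCycle_congr (fun i hi ↦ ha i hi.le) hs]

/-- The sequence made of the first `n` terms of `a` followed by `b`. -/
def prepend (n : ℕ) (a b : ℕ → ℝ) (i : ℕ) : ℝ := if i < n then a i else b (i - n)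

variable {b s' : ℕ → ℝ} {n k : ℕ}

lemma prepend_of_lt (h : k < n) : prepend n a b k = a k := if_pos h

@[simp] lemma prepend_add (n k : ℕ) : prepend n a b (n + k) = b k := by simp [prepend]

lemma arrivalTime_prepend_of_lt (h : k < n) : arrivalTime (prepend n a b) k = arrivalTime a k :=
  arrivalTime_congr fun _ hi ↦ prepend_of_lt (hi.trans_lt h)

lemma arrivalTime_prepend_add (n k : ℕ) :
    arrivalTime (prepend n a b) (n + k) = prevArrivalTime a n + arrivalTime b k := by
  rw [arrivalTime, add_assoc, Finset.sum_range_add]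
  simp only [prepend_add, arrivalTime]
  congr 1
  exact Finset.sum_congr rfl fun i hi ↦ prepend_of_lt (Finset.mem_range.1 hi)

lemma mem_present_prepend_of_lt (h : k < n) {t : ℝ} :
    k ∈ present (prepend n a b) (prepend n s s') t ↔ k ∈ present a s t := by
  simp only [present, mem_ofPred_eq, arrivalTime_prepend_of_lt h, prepend_of_lt h]

lemma add_mem_present_prepend {t : ℝ} :
    n + k ∈ present (prepend n a b) (prepend n s s') t
      ↔ k ∈ present b s' (t - prevArrivalTime a n) := by
  simp only [present, mem_ofPred_eq, arrivalTime_prepend_add, prepend_add, le_sub_iff_add_le',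
    sub_lt_iff_lt_add', add_assoc]

end Paths

section Measurability

variable {β : Type*} [MeasurableSpace β] {a s : β → ℕ → ℝ} {f : β → ℝ}

@[fun_prop]
lemma measurable_arrivalTime (ha : Measurable a) (n : ℕ) :
    Measurable fun x ↦ arrivalTime (a x) n :=
  Finset.measurable_fun_sum _ fun i _ ↦ (measurable_pi_apply i).comp ha

@[fun_prop]
lemma measurable_prevArrivalTime (ha : Measurable a) (n : ℕ) :
    Measurable fun x ↦ prevArrivalTime (a x) n :=
  Finset.measurable_fun_sum _ fun i _ ↦ (measurable_pi_apply i).comp ha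

lemma measurableSet_mem_present (ha : Measurable a) (hs : Measurable s) (hf : Measurable f)
    (n : ℕ) : MeasurableSet {x | n ∈ present (a x) (s x) (f x)} :=
  (measurableSet_le (by fun_prop) hf).inter (measurableSet_lt hf (by fun_prop))

lemma measurableSet_forall_notMem_present (ha : Measurable a) (hs : Measurable s)
    (hf : Measurable f) (m : ℕ) :
    MeasurableSet {x | ∀ k < m, k ∉ present (a x) (s x) (f x)} := by
  simp only [ofPred_forall]
  exact .iInter fun k ↦ .iInter fun _ ↦ (measurableSet_mem_present ha hs hf k).compl

lemma measurableSet_sustained (ha : Measurable a) (hs : Measurable s) (hf : Measurable f)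
    (k : ℕ) : MeasurableSet {x | Sustained (a x) (s x) k (f x)} := by
  simp only [Sustained, ofPred_or, ofPred_exists, ofPred_and]
  exact (MeasurableSet.const _).union <| .iUnion fun j ↦ (MeasurableSet.const _).inter <|
    measurableSet_le hf (by fun_prop)

lemma measurableSet_continuesCycle (ha : Measurable a) (hs : Measurable s) (hf : Measurable f)
    (n : ℕ) : MeasurableSet {x | ContinuesCycle (a x) (s x) n (f x)} := by
  simp only [ContinuesCycle, ofPred_and, ofPred_forall]
  exact (MeasurableSet.iInter fun k ↦ .iInter fun _ ↦
    measurableSet_sustained ha hs (by fun_prop) k).inter (measurableSet_sustained ha hs hf n)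

lemma measurableSet_inFirstCycle (ha : Measurable a) (hs : Measurable s) (n : ℕ) :
    MeasurableSet {x | InFirstCycle (a x) (s x) n} := by
  simp only [inFirstCycle_iff_continuesCycle]
  exact measurableSet_continuesCycle ha hs (by fun_prop) n

lemma measurableSet_awaitsArrival (ha : Measurable a) (hs : Measurable s) (hf : Measurable f)
    (n : ℕ) : MeasurableSet {x | AwaitsArrival (a x) (s x) n (f x)} :=
  (measurableSet_continuesCycle ha hs hf n).inter <|
    (measurableSet_le (by fun_prop) hf).inter (measurableSet_lt hf (by fun_prop))

lemma measurableSet_unfinished (ha : Measurable a) (hs : Measurable s) (hf : Measurable f) :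
    MeasurableSet {x | Unfinished (a x) (s x) (f x)} := by
  simp only [Unfinished, ofPred_or, ofPred_exists]
  exact (measurableSet_lt hf (by fun_prop)).union <| .iUnion fun n ↦
    (measurableSet_inFirstCycle ha hs n).inter (measurableSet_mem_present ha hs hf n)

end Measurability

section RealLaw

lemma ae_pos {ν : Measure ℝ} (hν : ν (Iic 0) = 0) : ∀ᵐ z ∂ν, 0 < z :=
  (measure_eq_zero_iff_ae_notMem.1 hν).mono fun _ h ↦ not_le.1 h

lemma exists_pos_measure_Ioi_ne_zero {ν : Measure ℝ} [NeZero ν] (hν : ν (Iic 0) = 0) :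
    ∃ c > 0, ν (Ioi c) ≠ 0 := by
  by_contra! hzero
  have hle : ∀ᵐ z ∂ν, ∀ n : ℕ, z ≤ 1 / ((n : ℝ) + 1) := ae_all_iff.2 fun n ↦
    (measure_eq_zero_iff_ae_notMem.1 (hzero _ Nat.one_div_pos_of_nat)).mono fun _ h ↦ not_lt.1 h
  obtain ⟨z, hz, hz'⟩ := (hle.and (ae_pos hν)).exists
  exact absurd (ge_of_tendsto' tendsto_one_div_add_atTop_nhds_zero_nat hz) hz'.not_ge

lemma ae_ae_ne {X : Type*} [MeasurableSpace X] {Q : Measure X} [SFinite Q] {f : X → ℝ}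
    (hf : Measurable f) : ∀ᵐ u, ∀ᵐ x ∂Q, u ≠ f x := by
  have hne : MeasurableSet {p : X × ℝ | p.2 ≠ f p.1} :=
    (measurableSet_eq_fun measurable_snd (by fun_prop)).compl
  exact (Measure.ae_ae_comm hne).1 (ae_of_all Q fun x ↦ Measure.ae_ne volume (f x))

end RealLaw

section PathSpace

/-- The interarrival times of a path, where a path lists the interarrival times (left summand) and
the service times (right summand) of a queue. -/
def interarrival (x : ℕ ⊕ ℕ → ℝ) (n : ℕ) : ℝ := x (.inl n)

/-- The service times of a path. -/
def service (x : ℕ ⊕ ℕ → ℝ) (n : ℕ) : ℝ := x (.inr n)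

@[fun_prop]
lemma measurable_interarrival : Measurable interarrival :=
  measurable_pi_lambda _ fun _ ↦ measurable_pi_apply _

@[fun_prop]
lemma measurable_service : Measurable service :=
  measurable_pi_lambda _ fun _ ↦ measurable_pi_apply _

/-- The path in which the first `n` customers are those of `x` and the next ones are the customers
of `y`. -/
def prependPath (n : ℕ) (x y : ℕ ⊕ ℕ → ℝ) : ℕ ⊕ ℕ → ℝ :=
  Sum.elim (prepend n (interarrival x) (interarrival y)) (prepend n (service x) (service y))

variable {x : ℕ ⊕ ℕ → ℝ} {n k : ℕ} {z : ℝ}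

lemma interarrival_update_inl_of_ne (h : k ≠ n) :
    interarrival (Function.update x (.inl n) z) k = interarrival x k := by
  simp [interarrival, h]

@[simp] lemma interarrival_update_inl_self :
    interarrival (Function.update x (.inl n) z) n = z := by
  simp [interarrival]

@[simp] lemma service_update_inl : service (Function.update x (.inl n) z) = service x := by
  ext; simp [service]

@[simp] lemma interarrival_update_inr :
    interarrival (Function.update x (.inr n) z) = interarrival x := by
  ext; simp [interarrival]

lemma service_update_inr_of_ne (h : k ≠ n) :
    service (Function.update x (.inr n) z) k = service x k := by
  simp [service, h]

@[simp] lemma service_update_inr_self : service (Function.update x (.inr n) z) n = z := by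
  simp [service]

/-- The law of the path of a queue whose interarrival times and service times are all independent,
the former with law `ν` and the latter with law `σ`. -/
noncomputable def pathLaw (ν σ : Measure ℝ) [IsProbabilityMeasure ν] [IsProbabilityMeasure σ] :
    Measure (ℕ ⊕ ℕ → ℝ) :=
  Measure.infinitePi (Sum.elim (fun _ ↦ ν) fun _ ↦ σ)

variable {ν σ : Measure ℝ} [IsProbabilityMeasure ν] [IsProbabilityMeasure σ]

instance : IsProbabilityMeasure (pathLaw ν σ) := by
  unfold pathLaw
  infer_instance

lemma measurePreserving_interarrival (n : ℕ) :
    MeasurePreserving (fun x ↦ interarrival x n) (pathLaw ν σ) ν :=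
  measurePreserving_eval_infinitePi _ (Sum.inl n)

lemma measurePreserving_service (n : ℕ) :
    MeasurePreserving (fun x ↦ service x n) (pathLaw ν σ) σ :=
  measurePreserving_eval_infinitePi _ (Sum.inr n)

lemma lintegral_pathLaw_update_inl (n : ℕ) {Φ : (ℕ ⊕ ℕ → ℝ) → ℝ≥0∞} (hΦ : Measurable Φ) :
    ∫⁻ x, Φ x ∂pathLaw ν σ
      = ∫⁻ x, ∫⁻ y, Φ (Function.update x (.inl n) y) ∂ν ∂pathLaw ν σ :=
  lintegral_infinitePi_update _ (Sum.inl n) hΦ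

lemma lintegral_pathLaw_update_inr (n : ℕ) {Φ : (ℕ ⊕ ℕ → ℝ) → ℝ≥0∞} (hΦ : Measurable Φ) :
    ∫⁻ x, Φ x ∂pathLaw ν σ
      = ∫⁻ x, ∫⁻ y, Φ (Function.update x (.inr n) y) ∂σ ∂pathLaw ν σ :=
  lintegral_infinitePi_update _ (Sum.inr n) hΦ

lemma measure_pathLaw_update_inl (n : ℕ) {A : Set (ℕ ⊕ ℕ → ℝ)} (hA : MeasurableSet A) :
    pathLaw ν σ A = ∫⁻ x, ν {y | Function.update x (.inl n) y ∈ A} ∂pathLaw ν σ := by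
  rw [← lintegral_indicator_one hA, lintegral_pathLaw_update_inl n (measurable_one.indicator hA)]
  exact lintegral_congr fun x ↦ lintegral_indicator_one (measurable_update x hA)

lemma measure_pathLaw_update_inr (n : ℕ) {A : Set (ℕ ⊕ ℕ → ℝ)} (hA : MeasurableSet A) :
    pathLaw ν σ A = ∫⁻ x, σ {y | Function.update x (.inr n) y ∈ A} ∂pathLaw ν σ := by
  rw [← lintegral_indicator_one hA, lintegral_pathLaw_update_inr n (measurable_one.indicator hA)]
  exact lintegral_congr fun x ↦ lintegral_indicator_one (measurable_update x hA)

lemma measure_pathLaw_prependPath (n : ℕ) {A : Set (ℕ ⊕ ℕ → ℝ)} (hA : MeasurableSet A) :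
    pathLaw ν σ A = ∫⁻ x, pathLaw ν σ {y | prependPath n x y ∈ A} ∂pathLaw ν σ := by
  let f : ℕ ⊕ ℕ → (ℕ ⊕ ℕ) ⊕ (ℕ ⊕ ℕ) := Sum.elim
    (fun i ↦ if i < n then .inl (.inl i) else .inr (.inl (i - n)))
    (fun i ↦ if i < n then .inl (.inr i) else .inr (.inr (i - n)))
  have hf : f.Injective := by
    rintro (i | i) (j | j) hij <;> simp only [f, Sum.elim_inl, Sum.elim_inr] at hij <;> grind
  have hprepend (x y : ℕ ⊕ ℕ → ℝ) : (fun i ↦ Sum.elim x y (f i)) = prependPath n x y := by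
    ext (i | i) <;> by_cases h : i < n <;> simp [f, prependPath, prepend, interarrival, service, h]
  have hmeas (x : ℕ ⊕ ℕ → ℝ) : Measurable (prependPath n x) := by
    rw [← funext (hprepend x)]
    refine measurable_pi_lambda _ fun i ↦ ?_
    rcases f i with j | j <;> simp only [Sum.elim_inl, Sum.elim_inr] <;> fun_prop
  rw [← lintegral_indicator_one hA, pathLaw,
    lintegral_infinitePi_resample _ hf ?_ (measurable_one.indicator hA)]
  · simp only [hprepend]
    exact lintegral_congr fun x ↦ lintegral_indicator_one (hmeas x hA)
  · rintro (i | i) <;> by_cases h : i < n <;> simp [f, h]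

lemma ae_interarrival_pos (hν : ν (Iic 0) = 0) :
    ∀ᵐ x ∂pathLaw ν σ, ∀ n, 0 < interarrival x n :=
  ae_all_iff.2 fun n ↦
    (measurePreserving_interarrival n).quasiMeasurePreserving.ae (ae_pos hν)

lemma ae_service_pos (hσ : σ (Iic 0) = 0) :
    ∀ᵐ x ∂pathLaw ν σ, ∀ n, 0 < service x n :=
  ae_all_iff.2 fun n ↦ (measurePreserving_service n).quasiMeasurePreserving.ae (ae_pos hσ)

lemma iIndepFun_interarrival : iIndepFun (fun n x ↦ interarrival x n) (pathLaw ν σ) :=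
  (iIndepFun_infinitePi (X := fun _ z ↦ z) fun _ ↦ measurable_id).precomp Sum.inl_injective

lemma ae_frequently_lt_interarrival {c : ℝ} (hc : ν (Ioi c) ≠ 0) :
    ∀ᵐ x ∂pathLaw ν σ, ∃ᶠ n in atTop, c < interarrival x n := by
  let E (n : ℕ) : Set (ℕ ⊕ ℕ → ℝ) := {x | c < interarrival x n}
  have hE (n : ℕ) : MeasurableSet (E n) := measurableSet_lt (by fun_prop) (by fun_prop)
  have hindep : iIndepSet E (pathLaw ν σ) := (iIndepSet_iff_meas_biInter hE).2 fun s ↦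
    iIndepFun_interarrival.measure_inter_preimage_eq_mul s (sets := fun _ ↦ Ioi c)
      fun _ _ ↦ measurableSet_Ioi
  have hsum : ∑' n, pathLaw ν σ (E n) = ∞ := by
    have h (n : ℕ) : pathLaw ν σ (E n) = ν (Ioi c) :=
      (measurePreserving_interarrival n).measure_preimage measurableSet_Ioi.nullMeasurableSet
    simp only [h, ENNReal.tsum_const_eq_top_of_ne_zero hc]
  have hlimsup := (mem_ae_iff_prob_eq_one (.measurableSet_limsup hE)).2
    (measure_limsup_eq_one hE hindep hsum)
  exact Filter.Eventually.mono hlimsup fun x ↦ mem_limsup_iff_frequently_mem.1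

lemma ae_exists_lt_arrivalTime (hν : ν (Iic 0) = 0) :
    ∀ᵐ x ∂pathLaw ν σ, ∀ u, ∃ n, u < arrivalTime (interarrival x) n := by
  obtain ⟨c, hc, hc'⟩ := exists_pos_measure_Ioi_ne_zero hν
  filter_upwards [ae_interarrival_pos hν, ae_frequently_lt_interarrival hc'] with x hpos hfreq
  exact exists_lt_arrivalTime_of_frequently hpos hc hfreq

end PathSpace

section CycleTail

variable {ν σ : Measure ℝ} [IsProbabilityMeasure ν] [IsProbabilityMeasure σ]

/-- The probability that the first busy cycle is not over at time `t`, in a queue with interarrival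
law `ν` and service law `σ`. -/
noncomputable def cycleTail (ν σ : Measure ℝ) [IsProbabilityMeasure ν] [IsProbabilityMeasure σ]
    (t : ℝ) : ℝ≥0∞ :=
  pathLaw ν σ {x | Unfinished (interarrival x) (service x) t}

@[fun_prop]
lemma measurable_cycleTail : Measurable (cycleTail ν σ) := by
  have h : MeasurableSet {p : (ℕ ⊕ ℕ → ℝ) × ℝ |
      Unfinished (interarrival p.1) (service p.1) p.2} :=
    measurableSet_unfinished (by fun_prop) (by fun_prop) measurable_snd
  exact measurable_measure_prodMk_right h

end CycleTail

section ArrivalIntensity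

variable {x : ℕ ⊕ ℕ → ℝ} {n : ℕ} {u z : ℝ}

lemma prevArrivalTime_update_inl :
    prevArrivalTime (interarrival (Function.update x (.inl n) z)) n
      = prevArrivalTime (interarrival x) n :=
  prevArrivalTime_congr fun _ hi ↦ interarrival_update_inl_of_ne hi.ne

lemma arrivalTime_update_inl :
    arrivalTime (interarrival (Function.update x (.inl n) z)) n
      = prevArrivalTime (interarrival x) n + z := by
  rw [arrivalTime_eq_prevArrivalTime_add, prevArrivalTime_update_inl, interarrival_update_inl_self]

lemma continuesCycle_update_inl :
    ContinuesCycle (interarrival (Function.update x (.inl n) z))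
      (service (Function.update x (.inl n) z)) n u
      ↔ ContinuesCycle (interarrival x) (service x) n u :=
  continuesCycle_congr (fun _ hi ↦ interarrival_update_inl_of_ne hi.ne) fun i _ ↦ by simp

lemma inFirstCycle_update_inl :
    InFirstCycle (interarrival (Function.update x (.inl n) z))
      (service (Function.update x (.inl n) z)) n
      ↔ ContinuesCycle (interarrival x) (service x) n (prevArrivalTime (interarrival x) n + z) := by
  rw [inFirstCycle_iff_continuesCycle, arrivalTime_update_inl, continuesCycle_update_inl]

lemma awaitsArrival_update_inl :
    AwaitsArrival (interarrival (Function.update x (.inl n) z))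
      (service (Function.update x (.inl n) z)) n u
      ↔ ContinuesCycle (interarrival x) (service x) n u ∧ prevArrivalTime (interarrival x) n ≤ u ∧
        u < prevArrivalTime (interarrival x) n + z := by
  rw [AwaitsArrival, continuesCycle_update_inl, prevArrivalTime_update_inl, arrivalTime_update_inl]

variable {lam : ℝ} [Fact (0 < lam)] {σ : Measure ℝ} [IsProbabilityMeasure σ]

instance : IsProbabilityMeasure (expMeasure lam) := isProbabilityMeasure_expMeasure Fact.out

/- Given everything but the `n`-th interarrival time, the `n`-th arrival has a hazard rate `lam`
from the previous arrival on. -/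
lemma setLIntegral_inFirstCycle (n : ℕ) {g : ℝ → ℝ≥0∞} (hg : Measurable g) :
    ∫⁻ x in {x | InFirstCycle (interarrival x) (service x) n},
        g (arrivalTime (interarrival x) n) ∂pathLaw (expMeasure lam) σ
      = ∫⁻ u, ENNReal.ofReal lam * g u * pathLaw (expMeasure lam) σ
          {x | AwaitsArrival (interarrival x) (service x) n u} := by
  have hcycle := measurableSet_inFirstCycle measurable_interarrival measurable_service n
  have hawaits : MeasurableSet {p : (ℕ ⊕ ℕ → ℝ) × ℝ |
      AwaitsArrival (interarrival p.1) (service p.1) n p.2} :=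
    measurableSet_awaitsArrival (by fun_prop) (by fun_prop) measurable_snd n
  let q (x : ℕ ⊕ ℕ → ℝ) (u : ℝ) : ℝ≥0∞ := expMeasure lam {z | AwaitsArrival
    (interarrival (Function.update x (.inl n) z)) (service (Function.update x (.inl n) z)) n u}
  have hq : Measurable q.uncurry := by
    have hupdate : Measurable fun p : ((ℕ ⊕ ℕ → ℝ) × ℝ) × ℝ ↦
        (Function.update p.1.1 (Sum.inl n) p.2, p.1.2) := by fun_prop
    exact measurable_measure_prodMk_left (hupdate hawaits)
  have hqint (u : ℝ) : pathLaw (expMeasure lam) σ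
      {x | AwaitsArrival (interarrival x) (service x) n u}
        = ∫⁻ x, q x u ∂pathLaw (expMeasure lam) σ :=
    measure_pathLaw_update_inl n (hawaits.preimage measurable_prodMk_right)
  let h (x : ℕ ⊕ ℕ → ℝ) : ℝ → ℝ≥0∞ :=
    {u | ContinuesCycle (interarrival x) (service x) n u}.indicator g
  have hh (x : ℕ ⊕ ℕ → ℝ) : Measurable (h x) := hg.indicator <|
    measurableSet_continuesCycle measurable_const measurable_const measurable_id n
  rw [← lintegral_indicator hcycle,
    lintegral_pathLaw_update_inl n (.indicator (by fun_prop) hcycle)]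
  calc _ = ∫⁻ x, (∫⁻ z, h x (prevArrivalTime (interarrival x) n + z) ∂expMeasure lam)
            ∂pathLaw (expMeasure lam) σ := by
        refine lintegral_congr fun x ↦ lintegral_congr fun z ↦ ?_
        exact indicator_eq_indicator inFirstCycle_update_inl (congrArg g arrivalTime_update_inl)
    _ = ∫⁻ x, (∫⁻ u, ENNReal.ofReal lam * g u * q x u) ∂pathLaw (expMeasure lam) σ := by
        refine lintegral_congr fun x ↦ ?_
        rw [lintegral_expMeasure_add Fact.out _ (hh x)]
        refine lintegral_congr fun u ↦ ?_
        simp only [q, awaitsArrival_update_inl, h, indicator, mem_ofPred_eq]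
        split_ifs with hu <;> simp [hu]
    _ = ∫⁻ u, (∫⁻ x, ENNReal.ofReal lam * g u * q x u ∂pathLaw (expMeasure lam) σ) :=
        lintegral_lintegral_swap (by fun_prop)
    _ = _ := by
        simp only [hqint, lintegral_const_mul _ hq.of_uncurry_right]

lemma tsum_measure_awaitsArrival (u : ℝ) :
    ∑' n, pathLaw (expMeasure lam) σ {x | AwaitsArrival (interarrival x) (service x) n u}
      = pathLaw (expMeasure lam) σ {x | ∃ n, AwaitsArrival (interarrival x) (service x) n u} := by
  rw [ofPred_exists, measure_iUnion₀]
  · refine fun m n hmn ↦ measure_eq_zero_iff_ae_notMem.2 ?_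
    filter_upwards [ae_interarrival_pos (expMeasure_Iic_zero Fact.out)] with x hx hmem
    exact hmn (AwaitsArrival.eq hx hmem.1 hmem.2)
  · exact fun n ↦ (measurableSet_awaitsArrival measurable_interarrival measurable_service
      measurable_const n).nullMeasurableSet

lemma ae_tsum_measure_awaitsArrival : ∀ᵐ u : ℝ,
    ∑' n, pathLaw (expMeasure lam) σ {x | AwaitsArrival (interarrival x) (service x) n u}
      = (Ici 0).indicator (cycleTail (expMeasure lam) σ) u := by
  have hexp := expMeasure_Iic_zero (r := lam) Fact.out
  have hdep : ∀ᵐ u : ℝ, ∀ j, ∀ᵐ x ∂pathLaw (expMeasure lam) σ,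
      u ≠ arrivalTime (interarrival x) j + service x j :=
    ae_all_iff.2 fun j ↦ ae_ae_ne (by fun_prop)
  filter_upwards [hdep] with u hu
  rw [tsum_measure_awaitsArrival, indicator]
  split_ifs with h0
  · refine measure_congr ?_
    filter_upwards [ae_interarrival_pos hexp, ae_exists_lt_arrivalTime hexp, ae_all_iff.2 hu]
      with x hx hx' hxu
    exact propext (unfinished_iff_exists_awaitsArrival hx h0 (hx' u) hxu).symm
  · refine measure_eq_zero_iff_ae_notMem.2 ?_
    filter_upwards [ae_interarrival_pos hexp] with x hx
    rintro ⟨n, -, hprev, -⟩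
    exact h0 ((prevArrivalTime_nonneg hx n).trans hprev)

lemma tsum_setLIntegral_inFirstCycle {g : ℝ → ℝ≥0∞} (hg : Measurable g) :
    ∑' n, ∫⁻ x in {x | InFirstCycle (interarrival x) (service x) n},
        g (arrivalTime (interarrival x) n) ∂pathLaw (expMeasure lam) σ
      = ∫⁻ u in Ici 0, ENNReal.ofReal lam * g u * cycleTail (expMeasure lam) σ u := by
  have hawaits (n : ℕ) : Measurable fun u ↦ pathLaw (expMeasure lam) σ
      {x | AwaitsArrival (interarrival x) (service x) n u} := by
    have h : MeasurableSet {p : (ℕ ⊕ ℕ → ℝ) × ℝ |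
        AwaitsArrival (interarrival p.1) (service p.1) n p.2} :=
      measurableSet_awaitsArrival (by fun_prop) (by fun_prop) measurable_snd n
    exact measurable_measure_prodMk_right h
  simp only [setLIntegral_inFirstCycle _ hg]
  rw [← lintegral_tsum (fun n ↦ by fun_prop), ← lintegral_indicator measurableSet_Ici]
  refine lintegral_congr_ae ?_
  filter_upwards [ae_tsum_measure_awaitsArrival (lam := lam) (σ := σ)] with u hu
  rw [ENNReal.tsum_mul_left, hu, indicator_mul_right]

end ArrivalIntensity

section Present

variable {x y : ℕ ⊕ ℕ → ℝ} {n k : ℕ} {t z : ℝ}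

lemma inFirstCycle_update_inr :
    InFirstCycle (interarrival (Function.update x (.inr n) z))
      (service (Function.update x (.inr n) z)) n
      ↔ InFirstCycle (interarrival x) (service x) n := by
  rw [interarrival_update_inr]
  exact inFirstCycle_congr (fun _ _ ↦ rfl) fun _ hi ↦ service_update_inr_of_ne hi.ne

lemma mem_present_update_inr :
    n ∈ present (interarrival (Function.update x (.inr n) z))
      (service (Function.update x (.inr n) z)) t
      ↔ arrivalTime (interarrival x) n ≤ t ∧ t < arrivalTime (interarrival x) n + z := by
  rw [present, mem_ofPred_eq, interarrival_update_inr, service_update_inr_self]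

lemma inFirstCycle_prependPath_succ :
    InFirstCycle (interarrival (prependPath (n + 1) x y)) (service (prependPath (n + 1) x y)) n
      ↔ InFirstCycle (interarrival x) (service x) n :=
  inFirstCycle_congr (fun _ hi ↦ prepend_of_lt (Nat.lt_succ_of_le hi))
    fun _ hi ↦ prepend_of_lt (hi.trans n.lt_succ_self)

lemma mem_present_prependPath_of_lt (h : k < n) :
    k ∈ present (interarrival (prependPath n x y)) (service (prependPath n x y)) t
      ↔ k ∈ present (interarrival x) (service x) t :=
  mem_present_prepend_of_lt h

lemma add_mem_present_prependPath :
    n + k ∈ present (interarrival (prependPath n x y)) (service (prependPath n x y)) t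
      ↔ k ∈ present (interarrival y) (service y) (t - prevArrivalTime (interarrival x) n) :=
  add_mem_present_prepend

variable {ν σ : Measure ℝ} [IsProbabilityMeasure ν] [IsProbabilityMeasure σ]

lemma measurableSet_inFirstCycle_and_mem_present (n : ℕ) (t : ℝ) :
    MeasurableSet {x | InFirstCycle (interarrival x) (service x) n ∧
      n ∈ present (interarrival x) (service x) t} :=
  (measurableSet_inFirstCycle measurable_interarrival measurable_service n).inter
    (measurableSet_mem_present measurable_interarrival measurable_service measurable_const n)

lemma measure_inFirstCycle_and_mem_present (n : ℕ) (t : ℝ) :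
    pathLaw ν σ {x | InFirstCycle (interarrival x) (service x) n ∧
        n ∈ present (interarrival x) (service x) t}
      = ∫⁻ x in {x | InFirstCycle (interarrival x) (service x) n},
          σ {z | arrivalTime (interarrival x) n ≤ t ∧ t < arrivalTime (interarrival x) n + z}
          ∂pathLaw ν σ := by
  rw [measure_pathLaw_update_inr n (measurableSet_inFirstCycle_and_mem_present n t),
    ← lintegral_indicator (measurableSet_inFirstCycle measurable_interarrival measurable_service n)]
  refine lintegral_congr fun x ↦ ?_
  simp only [mem_ofPred_eq, inFirstCycle_update_inr, mem_present_update_inr, indicator]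
  split_ifs with h <;> simp [h]

/-- The mean number of customers of the first busy cycle that are present at time `t`. -/
noncomputable def meanCyclePresent (ν σ : Measure ℝ) [IsProbabilityMeasure ν]
    [IsProbabilityMeasure σ] (t : ℝ) : ℝ≥0∞ :=
  ∑' n, pathLaw ν σ {x | InFirstCycle (interarrival x) (service x) n ∧
    n ∈ present (interarrival x) (service x) t}

lemma measure_lt_interarrival (n : ℕ) (t : ℝ) :
    pathLaw ν σ {x | t < interarrival x n} = ν (Ioi t) :=
  (measurePreserving_interarrival n).measure_preimage measurableSet_Ioi.nullMeasurableSet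

lemma cycleTail_le (t : ℝ) : cycleTail ν σ t ≤ ν (Ioi t) + meanCyclePresent ν σ t :=
  calc cycleTail ν σ t
      ≤ pathLaw ν σ {x | t < interarrival x 0} + pathLaw ν σ (⋃ n,
          {x | InFirstCycle (interarrival x) (service x) n ∧
            n ∈ present (interarrival x) (service x) t}) := by
        rw [cycleTail, ← ofPred_exists]
        exact measure_union_le _ _
    _ ≤ ν (Ioi t) + meanCyclePresent ν σ t := by
        rw [measure_lt_interarrival]
        gcongr
        exact measure_iUnion_le _

/-- Customer `n` belongs to the first busy cycle and is the last of the customers present at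
time `t`. -/
def IsLastPresent (a s : ℕ → ℝ) (n : ℕ) (t : ℝ) : Prop :=
  (InFirstCycle a s n ∧ n ∈ present a s t) ∧ ∀ k, n + 1 + k ∉ present a s t

lemma IsLastPresent.eq {a s : ℕ → ℝ} {m : ℕ} (hm : IsLastPresent a s m t)
    (hn : IsLastPresent a s n t) : m = n := by
  have hle {m n : ℕ} (hm : IsLastPresent a s m t) (hn : IsLastPresent a s n t) : n ≤ m := by
    by_contra! hlt
    obtain ⟨k, rfl⟩ := Nat.exists_eq_add_of_le hlt
    exact hm.2 k hn.1.2
  exact (hle hn hm).antisymm (hle hm hn)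

lemma measurableSet_isLastPresent (n : ℕ) (t : ℝ) :
    MeasurableSet {x | IsLastPresent (interarrival x) (service x) n t} := by
  simp only [IsLastPresent, ofPred_and (p := fun _ ↦ _ ∧ _), ofPred_forall]
  exact (measurableSet_inFirstCycle_and_mem_present n t).inter <| .iInter fun k ↦
    (measurableSet_mem_present measurable_interarrival measurable_service measurable_const _).compl

lemma isLastPresent_prependPath :
    IsLastPresent (interarrival (prependPath (n + 1) x y)) (service (prependPath (n + 1) x y)) n t
      ↔ (InFirstCycle (interarrival x) (service x) n ∧
          n ∈ present (interarrival x) (service x) t) ∧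
        present (interarrival y) (service y) (t - prevArrivalTime (interarrival x) (n + 1))
          = ∅ := by
  simp only [IsLastPresent, inFirstCycle_prependPath_succ,
    mem_present_prependPath_of_lt n.lt_succ_self, add_mem_present_prependPath,
    eq_empty_iff_forall_notMem]

variable {q : ℝ≥0∞}

/- The customers after customer `n` form a fresh queue, started at the arrival of `n`. -/
lemma mul_measure_le_measure_isLastPresent
    (hq : ∀ r, q ≤ pathLaw ν σ {y | present (interarrival y) (service y) r = ∅}) (n : ℕ) (t : ℝ) :
    q * pathLaw ν σ {x | InFirstCycle (interarrival x) (service x) n ∧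
        n ∈ present (interarrival x) (service x) t}
      ≤ pathLaw ν σ {x | IsLastPresent (interarrival x) (service x) n t} := by
  rw [measure_pathLaw_prependPath (n + 1) (measurableSet_isLastPresent n t),
    ← lintegral_indicator_const (measurableSet_inFirstCycle_and_mem_present n t)]
  refine lintegral_mono fun x ↦ indicator_apply_le' (fun hx ↦ ?_) fun _ ↦ zero_le
  simp only [mem_ofPred_eq, isLastPresent_prependPath, hx.1, hx.2, true_and]
  exact hq _

lemma le_cycleTail (hν : ν (Iic 0) = 0)
    (hq : ∀ r, q ≤ pathLaw ν σ {y | present (interarrival y) (service y) r = ∅}) (t : ℝ) :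
    ν (Ioi t) + q * meanCyclePresent ν σ t ≤ cycleTail ν σ t := by
  let D (n : ℕ) : Set (ℕ ⊕ ℕ → ℝ) := {x | IsLastPresent (interarrival x) (service x) n t}
  have hD (n : ℕ) : MeasurableSet (D n) := measurableSet_isLastPresent n t
  have hdisj : AEDisjoint (pathLaw ν σ) {x | t < interarrival x 0} (⋃ n, D n) := by
    refine measure_eq_zero_iff_ae_notMem.2 ?_
    filter_upwards [ae_interarrival_pos hν] with x hx
    rintro ⟨ht, hmem⟩
    obtain ⟨n, hn⟩ := mem_iUnion.1 hmem
    exact (((le_arrivalTime hx n).trans hn.1.2.1).trans_lt ht).false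
  calc ν (Ioi t) + q * meanCyclePresent ν σ t
      ≤ pathLaw ν σ {x | t < interarrival x 0} + ∑' n, pathLaw ν σ (D n) := by
        rw [measure_lt_interarrival, meanCyclePresent, ← ENNReal.tsum_mul_left]
        gcongr with n
        exact mul_measure_le_measure_isLastPresent hq n t
    _ = pathLaw ν σ ({x | t < interarrival x 0} ∪ ⋃ n, D n) := by
        rw [measure_union₀ (MeasurableSet.iUnion hD).nullMeasurableSet hdisj,
          measure_iUnion (fun m n hmn ↦ disjoint_left.2 fun x hm hn ↦ hmn (hm.eq hn)) hD]
    _ ≤ cycleTail ν σ t := measure_mono <| union_subset (fun x hx ↦ .inl hx) <|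
        iUnion_subset fun n x hx ↦ .inr ⟨n, hx.1⟩

end Present

section PoissonArrivals

variable {lam : ℝ} [Fact (0 < lam)] {σ : Measure ℝ} [IsProbabilityMeasure σ]

lemma meanCyclePresent_expMeasure (t : ℝ) :
    meanCyclePresent (expMeasure lam) σ t = ∫⁻ u in Icc 0 t,
      ENNReal.ofReal lam * σ (Ioi (t - u)) * cycleTail (expMeasure lam) σ u := by
  have hmeas : Measurable fun u ↦ σ {z | u ≤ t ∧ t < u + z} := by
    have h : MeasurableSet {p : ℝ × ℝ | p.1 ≤ t ∧ t < p.1 + p.2} :=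
      (measurableSet_le measurable_fst measurable_const).inter
        (measurableSet_lt measurable_const (measurable_fst.add measurable_snd))
    exact measurable_measure_prodMk_left h
  simp only [meanCyclePresent, measure_inFirstCycle_and_mem_present]
  rw [tsum_setLIntegral_inFirstCycle hmeas, ← lintegral_indicator measurableSet_Ici,
    ← lintegral_indicator measurableSet_Icc]
  refine lintegral_congr fun u ↦ ?_
  have hIoi : {z | t < u + z} = Ioi (t - u) := by ext z; simp [sub_lt_iff_lt_add']
  by_cases hu : u ≤ t <;> by_cases hu0 : 0 ≤ u <;> simp [hu, hu0, hIoi]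

end PoissonArrivals

section Emptiness

variable {ν σ : Measure ℝ} [IsProbabilityMeasure ν] [IsProbabilityMeasure σ]

/-- The probability that none of the first `m` customers is present at time `r`. -/
noncomputable def probNonePresent (ν σ : Measure ℝ) [IsProbabilityMeasure ν]
    [IsProbabilityMeasure σ] (m : ℕ) (r : ℝ) : ℝ≥0∞ :=
  pathLaw ν σ {x | ∀ k < m, k ∉ present (interarrival x) (service x) r}

@[fun_prop]
lemma measurable_probNonePresent (m : ℕ) : Measurable (probNonePresent ν σ m) := by
  have h : MeasurableSet {p : (ℕ ⊕ ℕ → ℝ) × ℝ |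
      ∀ k < m, k ∉ present (interarrival p.1) (service p.1) p.2} :=
    measurableSet_forall_notMem_present (by fun_prop) (by fun_prop) measurable_snd m
  exact measurable_measure_prodMk_right h

lemma measurableSet_not_le_and_lt_add (r : ℝ) :
    MeasurableSet {p : ℝ × ℝ | ¬(p.1 ≤ r ∧ r < p.1 + p.2)} :=
  ((measurableSet_le measurable_fst measurable_const).inter
    (measurableSet_lt measurable_const (measurable_fst.add measurable_snd))).compl

lemma measurable_measure_not_le_and_lt_add (r : ℝ) :
    Measurable fun a ↦ σ {z | ¬(a ≤ r ∧ r < a + z)} :=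
  measurable_measure_prodMk_left (measurableSet_not_le_and_lt_add r)

lemma forall_lt_succ_notMem_present_prependPath {x y : ℕ ⊕ ℕ → ℝ} {m : ℕ} {r : ℝ} :
    (∀ k < m + 1, k ∉ present (interarrival (prependPath 1 x y)) (service (prependPath 1 x y)) r)
      ↔ 0 ∉ present (interarrival x) (service x) r ∧
        ∀ k < m, k ∉ present (interarrival y) (service y) (r - interarrival x 0) := by
  rw [Nat.forall_lt_succ_left, mem_present_prependPath_of_lt one_pos]
  simp only [Nat.add_comm _ 1, add_mem_present_prependPath, prevArrivalTime,
    Finset.sum_range_one]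

lemma probNonePresent_succ (m : ℕ) (r : ℝ) :
    probNonePresent ν σ (m + 1) r
      = ∫⁻ a, σ {z | ¬(a ≤ r ∧ r < a + z)} * probNonePresent ν σ m (r - a) ∂ν := by
  let E : Set (ℕ ⊕ ℕ → ℝ) := {x | 0 ∉ present (interarrival x) (service x) r}
  have hE : MeasurableSet E :=
    (measurableSet_mem_present measurable_interarrival measurable_service measurable_const 0).compl
  have hD (a : ℝ) : MeasurableSet {z | ¬(a ≤ r ∧ r < a + z)} :=
    measurable_prodMk_left (measurableSet_not_le_and_lt_add r)
  calc probNonePresent ν σ (m + 1) r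
      = ∫⁻ x, E.indicator (fun x ↦ probNonePresent ν σ m (r - interarrival x 0)) x
          ∂pathLaw ν σ := by
        rw [probNonePresent, measure_pathLaw_prependPath 1
          (measurableSet_forall_notMem_present (by fun_prop) (by fun_prop) measurable_const _)]
        refine lintegral_congr fun x ↦ ?_
        simp only [mem_ofPred_eq, forall_lt_succ_notMem_present_prependPath, probNonePresent,
          indicator, E]
        split_ifs with h <;> simp [h]
    _ = ∫⁻ x, σ {z | ¬(interarrival x 0 ≤ r ∧ r < interarrival x 0 + z)} *
          probNonePresent ν σ m (r - interarrival x 0) ∂pathLaw ν σ := by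
        rw [lintegral_pathLaw_update_inr 0 (.indicator (by fun_prop) hE)]
        refine lintegral_congr fun x ↦ ?_
        rw [mul_comm, ← lintegral_indicator_const (hD _)]
        refine lintegral_congr fun z ↦ indicator_eq_indicator ?_ (by rw [interarrival_update_inr])
        simp only [E, mem_ofPred_eq, mem_present_update_inr, arrivalTime_zero]
    _ = _ := (measurePreserving_interarrival 0).lintegral_comp
        (f := fun a ↦ σ {z | ¬(a ≤ r ∧ r < a + z)} * probNonePresent ν σ m (r - a))
        ((measurable_measure_not_le_and_lt_add r).mul (by fun_prop))

/- Conditioning on the first customer gives the renewal equation for the probability of an empty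
system, and each of its subsolutions `F` is a lower bound. -/
lemma le_probNonePresent_of_le_lintegral {F : ℝ → ℝ≥0∞} (hF : ∀ r, F r ≤ 1)
    (h : ∀ r, F r ≤ ∫⁻ a, σ {z | ¬(a ≤ r ∧ r < a + z)} * F (r - a) ∂ν) (m : ℕ) (r : ℝ) :
    F r ≤ probNonePresent ν σ m r := by
  induction m generalizing r with
  | zero => simpa [probNonePresent] using hF r
  | succ m ih =>
    rw [probNonePresent_succ]
    exact (h r).trans (lintegral_mono fun a ↦ by gcongr; exact ih _)

lemma le_measure_present_eq_empty_of_le_lintegral {F : ℝ → ℝ≥0∞} (hF : ∀ r, F r ≤ 1)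
    (h : ∀ r, F r ≤ ∫⁻ a, σ {z | ¬(a ≤ r ∧ r < a + z)} * F (r - a) ∂ν) (r : ℝ) :
    F r ≤ pathLaw ν σ {x | present (interarrival x) (service x) r = ∅} := by
  have hiInter : {x | present (interarrival x) (service x) r = ∅}
      = ⋂ m, {x | ∀ k < m, k ∉ present (interarrival x) (service x) r} := by
    ext x
    simp only [mem_ofPred_eq, mem_iInter, eq_empty_iff_forall_notMem]
    exact ⟨fun hx _ k _ ↦ hx k, fun hx k ↦ hx (k + 1) k k.lt_succ_self⟩
  have hanti : Antitone fun m ↦ {x | ∀ k < m, k ∉ present (interarrival x) (service x) r} :=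
    fun _ _ hmn _ hx k hk ↦ hx k (hk.trans_le hmn)
  rw [hiInter, hanti.measure_iInter (fun m ↦ (measurableSet_forall_notMem_present (by fun_prop)
    (by fun_prop) measurable_const m).nullMeasurableSet) ⟨0, measure_ne_top _ _⟩]
  exact le_iInf fun m ↦ le_probNonePresent_of_le_lintegral hF h m r

end Emptiness

section PoissonEmptiness

variable {lam r : ℝ} {σ : Measure ℝ}

/-- The probability that the system is empty at time `r ≥ 0`, for Poisson arrivals of rate `lam`
and service law `σ`. -/
noncomputable def emptyProb (lam : ℝ) (σ : Measure ℝ) (r : ℝ) : ℝ :=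
  Real.exp (-(lam * ∫ v in 0..r, σ.real (Ioi v)))

lemma emptyProb_le_one (hlam : 0 ≤ lam) (hr : 0 ≤ r) : emptyProb lam σ r ≤ 1 :=
  Real.exp_le_one_iff.2 <| neg_nonpos.2 <| mul_nonneg hlam <|
    intervalIntegral.integral_nonneg hr fun _ _ ↦ measureReal_nonneg

@[simp] lemma emptyProb_zero : emptyProb lam σ 0 = 1 := by simp [emptyProb]

lemma intervalIntegrable_measureReal_Ioi [IsFiniteMeasure σ] (a b : ℝ) :
    IntervalIntegrable (fun v ↦ σ.real (Ioi v)) volume a b :=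
  Antitone.intervalIntegrable fun _ _ h ↦ measureReal_mono (Ioi_subset_Ioi h)

lemma intervalIntegrable_measureReal_Iic [IsFiniteMeasure σ] (a b : ℝ) :
    IntervalIntegrable (fun v ↦ σ.real (Iic v)) volume a b :=
  Monotone.intervalIntegrable fun _ _ h ↦ measureReal_mono (Iic_subset_Iic.2 h)

@[fun_prop]
lemma continuous_emptyProb [IsFiniteMeasure σ] : Continuous (emptyProb lam σ) :=
  ((intervalIntegral.continuous_primitive intervalIntegrable_measureReal_Ioi 0).const_mul
    lam).neg.rexp

variable [IsProbabilityMeasure σ]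

lemma measureReal_Ioi_eq_one_sub (v : ℝ) : σ.real (Ioi v) = 1 - σ.real (Iic v) := by
  rw [← compl_Iic, probReal_compl_eq_one_sub measurableSet_Iic]

lemma continuousWithinAt_measureReal_Ioi (v : ℝ) :
    ContinuousWithinAt (fun v ↦ σ.real (Ioi v)) (Ioi v) v := by
  simp only [measureReal_Ioi_eq_one_sub, ← cdf_eq_real]
  exact (((cdf σ).right_continuous v).mono Ioi_subset_Ici_self).const_sub 1

lemma hasDerivWithinAt_emptyProb (r : ℝ) :
    HasDerivWithinAt (emptyProb lam σ) (-(lam * σ.real (Ioi r)) * emptyProb lam σ r) (Ioi r) r := by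
  have hprim : HasDerivWithinAt (fun r ↦ ∫ v in 0..r, σ.real (Ioi v)) (σ.real (Ioi r)) (Ioi r) r :=
    (intervalIntegral.integral_hasDerivWithinAt_right (s := Ici r) (t := Ioi r)
      (intervalIntegrable_measureReal_Ioi 0 r)
      (Antitone.measurable fun _ _ h ↦
        measureReal_mono (Ioi_subset_Ioi h)).stronglyMeasurable.stronglyMeasurableAtFilter
      (continuousWithinAt_measureReal_Ioi r)).mono Ioi_subset_Ici_self
  rw [mul_comm]
  exact (hprim.const_mul lam).neg.exp

lemma intervalIntegral_mul_emptyProb_sub (hr : 0 ≤ r) :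
    ∫ a in 0..r, lam * Real.exp (-(lam * a)) * (σ.real (Iic (r - a)) * emptyProb lam σ (r - a))
      = emptyProb lam σ r - Real.exp (-(lam * r)) := by
  have hderiv (v : ℝ) : HasDerivWithinAt
      (fun v ↦ Real.exp (-(lam * (r - v))) * emptyProb lam σ v)
      (lam * Real.exp (-(lam * (r - v))) * (σ.real (Iic v) * emptyProb lam σ v)) (Ioi v) v := by
    have hexp : HasDerivAt (fun v ↦ Real.exp (-(lam * (r - v))))
        (Real.exp (-(lam * (r - v))) * -(lam * -1)) v :=
      (((hasDerivAt_id v).const_sub r).const_mul lam).neg.exp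
    refine (hexp.hasDerivWithinAt.mul (hasDerivWithinAt_emptyProb v)).congr_deriv ?_
    rw [measureReal_Ioi_eq_one_sub]
    ring
  calc
    _ = ∫ v in 0..r, lam * Real.exp (-(lam * (r - v))) * (σ.real (Iic v) * emptyProb lam σ v) := by
        simpa using intervalIntegral.integral_comp_sub_left (a := 0) (b := r)
          (fun v ↦ lam * Real.exp (-(lam * (r - v))) * (σ.real (Iic v) * emptyProb lam σ v)) r
    _ = _ := by
        rw [intervalIntegral.integral_eq_sub_of_hasDeriv_right_of_le hr
          (Continuous.continuousOn (by fun_prop)) fun v _ ↦ hderiv v]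
        · simp
        · exact ((intervalIntegrable_measureReal_Iic 0 r).mul_continuousOn
            continuous_emptyProb.continuousOn).continuousOn_mul
            (Continuous.continuousOn (by fun_prop))

lemma setLIntegral_Iic_mul_emptyProb_sub (hlam : 0 < lam) (hr : 0 ≤ r) :
    ∫⁻ a in Iic r, σ {z | ¬(a ≤ r ∧ r < a + z)} *
        ENNReal.ofReal (emptyProb lam σ (max (r - a) 0)) ∂expMeasure lam
      = ENNReal.ofReal (emptyProb lam σ r - Real.exp (-(lam * r))) := by
  have hmeas : Measurable fun a ↦ σ {z | ¬(a ≤ r ∧ r < a + z)} *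
      ENNReal.ofReal (emptyProb lam σ (max (r - a) 0)) :=
    (measurable_measure_not_le_and_lt_add r).mul (by fun_prop)
  have hint : IntervalIntegrable (fun a ↦ σ.real (Iic (r - a))) volume 0 r :=
    Antitone.intervalIntegrable fun _ _ h ↦
      measureReal_mono (Iic_subset_Iic.2 (sub_le_sub_left h r))
  rw [setLIntegral_Iic_expMeasure hmeas, ← intervalIntegral_mul_emptyProb_sub hr,
    ← setLIntegral_Icc_ofReal hr]
  · refine setLIntegral_congr_fun measurableSet_Icc fun a ha ↦ ?_
    have hIic : {z | ¬(a ≤ r ∧ r < a + z)} = Iic (r - a) := by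
      ext z
      simp [ha.2, le_sub_iff_add_le']
    simp only [hIic, max_eq_left (sub_nonneg.2 ha.2)]
    rw [ENNReal.ofReal_mul (p := lam * _) (by positivity), ENNReal.ofReal_mul measureReal_nonneg,
      ofReal_measureReal]
  · exact (hint.mul_continuousOn (Continuous.continuousOn (by fun_prop))).continuousOn_mul
      (Continuous.continuousOn (by fun_prop))
  · exact fun a _ ↦ mul_nonneg (by positivity) (mul_nonneg measureReal_nonneg (Real.exp_pos _).le)

lemma ofReal_emptyProb_le_lintegral (hlam : 0 < lam) (r : ℝ) :
    ENNReal.ofReal (emptyProb lam σ (max r 0)) ≤ ∫⁻ a, σ {z | ¬(a ≤ r ∧ r < a + z)} *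
      ENNReal.ofReal (emptyProb lam σ (max (r - a) 0)) ∂expMeasure lam := by
  have hIoi : ∫⁻ a in Ioi r, σ {z | ¬(a ≤ r ∧ r < a + z)} *
      ENNReal.ofReal (emptyProb lam σ (max (r - a) 0)) ∂expMeasure lam
        = expMeasure lam (Ioi r) := by
    rw [← setLIntegral_one]
    refine setLIntegral_congr_fun measurableSet_Ioi fun a ha ↦ ?_
    have ha' : r < a := ha
    simp [ha'.not_ge, max_eq_right (sub_neg.2 ha').le]
  rw [← lintegral_add_compl _ measurableSet_Iic, compl_Iic, hIoi]
  rcases lt_or_ge r 0 with hr | hr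
  · have := isProbabilityMeasure_expMeasure hlam
    have hIic : expMeasure lam (Iic r) = 0 :=
      measure_mono_null (Iic_subset_Iic.2 hr.le) (expMeasure_Iic_zero hlam)
    rw [max_eq_right hr.le, emptyProb_zero, ENNReal.ofReal_one, ← compl_Iic,
      (prob_compl_eq_one_iff measurableSet_Iic).2 hIic]
    exact le_add_self
  · rw [max_eq_left hr, setLIntegral_Iic_mul_emptyProb_sub hlam hr, expMeasure_Ioi hlam hr]
    refine le_trans ?_ ENNReal.ofReal_add_le
    rw [sub_add_cancel]

lemma exp_neg_mul_le_emptyProb_expMeasure {α : ℝ} (hlam : 0 ≤ lam) (hα : 0 < α) (hr : 0 ≤ r) :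
    Real.exp (-(lam * α)) ≤ emptyProb lam (expMeasure α⁻¹) r := by
  have hIoi : ∫ v in Ioi 0, Real.exp (-α⁻¹ * v) = α := by
    rw [integral_exp_mul_Ioi (by simpa using hα)]
    simp
  have hle : ∫ v in 0..r, (expMeasure α⁻¹).real (Ioi v) ≤ α :=
    calc ∫ v in 0..r, (expMeasure α⁻¹).real (Ioi v) = ∫ v in Ioc 0 r, Real.exp (-α⁻¹ * v) := by
          rw [intervalIntegral.integral_of_le hr]
          refine setIntegral_congr_fun measurableSet_Ioc fun v hv ↦ ?_
          simp only [measureReal_def, expMeasure_Ioi (inv_pos.2 hα) hv.1.le, neg_mul]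
          exact ENNReal.toReal_ofReal (Real.exp_pos _).le
      _ ≤ ∫ v in Ioi 0, Real.exp (-α⁻¹ * v) :=
          setIntegral_mono_set (integrableOn_exp_mul_Ioi (by simpa using hα) 0)
            (.of_forall fun _ ↦ (Real.exp_pos _).le) Ioc_subset_Ioi_self.eventuallyLE
      _ = α := hIoi
  exact Real.exp_le_exp.2 (neg_le_neg (mul_le_mul_of_nonneg_left hle hlam))

end PoissonEmptiness

section Volterra

variable {k f g h : ℝ → ℝ} {T : ℝ}

lemma neg_mul_pow_div_factorial_le_of_integral_le {d : ℝ → ℝ} {C M : ℝ} (hk : Continuous k)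
    (hk0 : ∀ v ∈ Icc 0 T, 0 ≤ k v) (hkC : ∀ v ∈ Icc 0 T, k v ≤ C) (hM : 0 ≤ M)
    (hdint : IntervalIntegrable d volume 0 T) (hdM : ∀ t ∈ Icc 0 T, -M ≤ d t)
    (hd : ∀ t ∈ Icc 0 T, ∫ u in 0..t, k (t - u) * d u ≤ d t) (n : ℕ) :
    ∀ t ∈ Icc 0 T, -(M * ((C * t) ^ n / n.factorial)) ≤ d t := by
  induction n with
  | zero => simpa using hdM
  | succ n ih =>
    intro t ht
    have hC : 0 ≤ C := (hk0 t ht).trans (hkC t ht)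
    have hsub : uIcc 0 t ⊆ uIcc 0 T := uIcc_subset_uIcc_left (by rwa [uIcc_of_le (ht.1.trans ht.2)])
    calc -(M * ((C * t) ^ (n + 1) / (n + 1).factorial))
        = ∫ u in 0..t, -(C * (M * ((C * u) ^ n / n.factorial))) := by
          have hpow (u : ℝ) : -(C * (M * ((C * u) ^ n / n.factorial)))
              = -(C ^ (n + 1) * M / n.factorial) * u ^ n := by ring
          simp only [hpow, intervalIntegral.integral_const_mul, integral_pow, Nat.factorial_succ]
          push_cast
          field_simp
          ring
      _ ≤ ∫ u in 0..t, k (t - u) * d u := by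
          refine intervalIntegral.integral_mono_on ht.1
            (Continuous.intervalIntegrable (by fun_prop) _ _)
            ((hdint.mono_set hsub).continuousOn_mul (by fun_prop)) fun u hu ↦ ?_
          have hu0 : 0 ≤ u := hu.1
          have htu : t - u ∈ Icc 0 T := ⟨sub_nonneg.2 hu.2, (sub_le_self _ hu.1).trans ht.2⟩
          calc -(C * (M * ((C * u) ^ n / n.factorial)))
              ≤ -(k (t - u) * (M * ((C * u) ^ n / n.factorial))) :=
                neg_le_neg (mul_le_mul_of_nonneg_right (hkC _ htu) (by positivity))
            _ ≤ k (t - u) * d u := by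
                rw [← mul_neg]
                exact mul_le_mul_of_nonneg_left (ih u ⟨hu.1, hu.2.trans ht.2⟩) (hk0 _ htu)
      _ ≤ d t := hd t ht

lemma nonneg_of_integral_le {d : ℝ → ℝ} (hk : Continuous k) (hk0 : ∀ v ∈ Icc 0 T, 0 ≤ k v)
    (hdint : IntervalIntegrable d volume 0 T) (hdbdd : BddBelow (d '' Icc 0 T))
    (hd : ∀ t ∈ Icc 0 T, ∫ u in 0..t, k (t - u) * d u ≤ d t) {t : ℝ} (ht : t ∈ Icc 0 T) :
    0 ≤ d t := by
  obtain ⟨C, hC⟩ := (isCompact_Icc (a := 0) (b := T)).bddAbove_image hk.continuousOn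
  obtain ⟨m, hm⟩ := hdbdd
  have hlower := neg_mul_pow_div_factorial_le_of_integral_le (C := C) (M := |m|) hk hk0
    (fun v hv ↦ hC (mem_image_of_mem k hv)) (abs_nonneg m) hdint
    (fun t ht ↦ (neg_abs_le m).trans (hm (mem_image_of_mem d ht))) hd
  have hlim : Tendsto (fun n : ℕ ↦ -(|m| * ((C * t) ^ n / n.factorial))) atTop (𝓝 0) := by
    simpa using ((FloorSemiring.tendsto_pow_div_factorial_atTop (C * t)).const_mul |m|).neg
  exact le_of_tendsto' hlim fun n ↦ hlower n t ht

lemma le_of_le_add_integral_of_add_integral_le (hk : Continuous k)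
    (hk0 : ∀ v ∈ Icc 0 T, 0 ≤ k v)
    (hfint : IntervalIntegrable f volume 0 T) (hfbdd : BddAbove (f '' Icc 0 T))
    (hgint : IntervalIntegrable g volume 0 T) (hgbdd : BddBelow (g '' Icc 0 T))
    (hf : ∀ t ∈ Icc 0 T, f t ≤ h t + ∫ u in 0..t, k (t - u) * f u)
    (hg : ∀ t ∈ Icc 0 T, h t + ∫ u in 0..t, k (t - u) * g u ≤ g t) {t : ℝ} (ht : t ∈ Icc 0 T) :
    f t ≤ g t := by
  obtain ⟨M, hM⟩ := hfbdd
  obtain ⟨m, hm⟩ := hgbdd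
  refine sub_nonneg.1 (nonneg_of_integral_le (d := fun t ↦ g t - f t) hk hk0 (hgint.sub hfint)
    ⟨m - M, ?_⟩ (fun t ht ↦ ?_) ht)
  · rintro _ ⟨t, ht, rfl⟩
    exact sub_le_sub (hm (mem_image_of_mem g ht)) (hM (mem_image_of_mem f ht))
  · have hsub : uIcc 0 t ⊆ uIcc 0 T := uIcc_subset_uIcc_left (by rwa [uIcc_of_le (ht.1.trans ht.2)])
    simp only [mul_sub]
    rw [intervalIntegral.integral_sub
      ((hgint.mono_set hsub).continuousOn_mul (by fun_prop))
      ((hfint.mono_set hsub).continuousOn_mul (by fun_prop))]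
    linarith [hf t ht, hg t ht]

end Volterra

section TailBound

/-- The solution of the Volterra equation `tailBound_eq`, of which the two bounds of the theorem
are the cases `q = 1` and `q = exp (-(lam * α))`. -/
noncomputable def tailBound (lam α q t : ℝ) : ℝ :=
  ((lam * α - 1) * Real.exp (-(lam * t)) +
    lam * α * q * Real.exp (-((1 - lam * α * q) / α * t))) / (lam * α * (1 + q) - 1)

@[fun_prop]
lemma continuous_tailBound (lam α q : ℝ) : Continuous (tailBound lam α q) := by
  unfold tailBound
  fun_prop

variable {lam α q : ℝ}

lemma tailBound_eq (hα : α ≠ 0) (hq : lam * α * (1 + q) - 1 ≠ 0) (t : ℝ) :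
    tailBound lam α q t = Real.exp (-(lam * t)) +
      ∫ u in 0..t, q * (lam * Real.exp (-(α⁻¹ * (t - u)))) * tailBound lam α q u := by
  have hsub (u : ℝ) : tailBound lam α q u - Real.exp (-(lam * u)) =
      lam * α * q * (Real.exp (-((1 - lam * α * q) / α * u)) - Real.exp (-(lam * u))) /
        (lam * α * (1 + q) - 1) := by
    rw [tailBound, div_sub' hq]
    ring
  have hexp (b u : ℝ) : HasDerivAt (fun u ↦ Real.exp (-(b * u)))
      (Real.exp (-(b * u)) * -(b * 1)) u :=
    ((hasDerivAt_id u).const_mul b).neg.exp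
  have hderiv (u : ℝ) : HasDerivAt
      (fun u ↦ Real.exp (-(α⁻¹ * (t - u))) * (tailBound lam α q u - Real.exp (-(lam * u))))
      (q * (lam * Real.exp (-(α⁻¹ * (t - u)))) * tailBound lam α q u) u := by
    have hdecay : HasDerivAt (fun u ↦ Real.exp (-(α⁻¹ * (t - u))))
        (Real.exp (-(α⁻¹ * (t - u))) * -(α⁻¹ * -1)) u :=
      (((hasDerivAt_id u).const_sub t).const_mul α⁻¹).neg.exp
    have hdiff := (((hexp ((1 - lam * α * q) / α) u).sub (hexp lam u)).const_mul
      (lam * α * q)).div_const (lam * α * (1 + q) - 1)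
    simp only [hsub]
    refine (hdecay.mul hdiff).congr_deriv ?_
    simp only [Pi.sub_apply]
    rw [tailBound]
    field_simp
    ring
  rw [intervalIntegral.integral_eq_sub_of_hasDerivAt (fun u _ ↦ hderiv u)
    (Continuous.intervalIntegrable (by fun_prop) _ _), hsub 0]
  simp

end TailBound

section ExponentialService

variable {lam α : ℝ} [Fact (0 < lam)] [Fact (0 < α)]

instance : Fact (0 < α⁻¹) := ⟨inv_pos.2 Fact.out⟩

lemma exp_neg_mul_le_measure_present_eq_empty (r : ℝ) :
    ENNReal.ofReal (Real.exp (-(lam * α))) ≤ pathLaw (expMeasure lam) (expMeasure α⁻¹)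
      {x | present (interarrival x) (service x) r = ∅} := by
  have hlam : 0 < lam := Fact.out
  refine le_trans (ENNReal.ofReal_le_ofReal
    (exp_neg_mul_le_emptyProb_expMeasure hlam.le Fact.out (le_max_right r 0))) ?_
  exact le_measure_present_eq_empty_of_le_lintegral
    (fun r ↦ ENNReal.ofReal_le_one.2 (emptyProb_le_one hlam.le (le_max_right r 0)))
    (ofReal_emptyProb_le_lintegral hlam) r

/-- The probability that the busy cycle of the `M|M|∞` queue with arrival rate `lam` and mean
service time `α` is not over at time `t`. -/
noncomputable def tail (lam α : ℝ) [Fact (0 < lam)] [Fact (0 < α)] (t : ℝ) : ℝ :=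
  (cycleTail (expMeasure lam) (expMeasure α⁻¹) t).toReal

lemma measurable_tail : Measurable (tail lam α) := measurable_cycleTail.ennreal_toReal

lemma tail_nonneg (t : ℝ) : 0 ≤ tail lam α t := ENNReal.toReal_nonneg

lemma tail_le_one (t : ℝ) : tail lam α t ≤ 1 := measureReal_le_one

lemma ofReal_tail (t : ℝ) :
    ENNReal.ofReal (tail lam α t) = cycleTail (expMeasure lam) (expMeasure α⁻¹) t :=
  ofReal_measureReal

lemma intervalIntegrable_tail (a b : ℝ) : IntervalIntegrable (tail lam α) volume a b := by
  rw [intervalIntegrable_iff]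
  refine Measure.integrableOn_of_bounded (M := 1) (by simp) measurable_tail.aestronglyMeasurable
    (.of_forall fun t ↦ ?_)
  rw [Real.norm_of_nonneg (tail_nonneg t)]
  exact tail_le_one t

lemma meanCyclePresent_eq_ofReal {t : ℝ} (ht : 0 ≤ t) :
    meanCyclePresent (expMeasure lam) (expMeasure α⁻¹) t
      = ENNReal.ofReal (∫ u in 0..t, lam * Real.exp (-(α⁻¹ * (t - u))) * tail lam α u) := by
  have hlam : 0 < lam := Fact.out
  rw [meanCyclePresent_expMeasure, ← setLIntegral_Icc_ofReal ht
    ((intervalIntegrable_tail 0 t).continuousOn_mul (Continuous.continuousOn (by fun_prop)))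
    fun u _ ↦ mul_nonneg (by positivity) (tail_nonneg u)]
  refine setLIntegral_congr_fun measurableSet_Icc fun u hu ↦ ?_
  simp only [expMeasure_Ioi (inv_pos.2 (Fact.out : 0 < α)) (sub_nonneg.2 hu.2)]
  rw [ENNReal.ofReal_mul (by positivity), ENNReal.ofReal_mul hlam.le, ofReal_tail]

lemma integral_mul_tail_nonneg {t : ℝ} (ht : 0 ≤ t) :
    0 ≤ ∫ u in 0..t, lam * Real.exp (-(α⁻¹ * (t - u))) * tail lam α u :=
  have hlam : 0 < lam := Fact.out
  intervalIntegral.integral_nonneg ht fun u _ ↦ mul_nonneg (by positivity) (tail_nonneg u)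

lemma tail_le_add_integral {t : ℝ} (ht : 0 ≤ t) :
    tail lam α t ≤ Real.exp (-(lam * t))
      + ∫ u in 0..t, lam * Real.exp (-(α⁻¹ * (t - u))) * tail lam α u := by
  have hint := integral_mul_tail_nonneg (lam := lam) (α := α) ht
  refine ENNReal.toReal_le_of_le_ofReal (by positivity) ?_
  rw [ENNReal.ofReal_add (by positivity) hint, ← meanCyclePresent_eq_ofReal ht,
    ← expMeasure_Ioi Fact.out ht]
  exact cycleTail_le t

lemma add_integral_le_tail {t : ℝ} (ht : 0 ≤ t) :
    Real.exp (-(lam * t)) + Real.exp (-(lam * α)) *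
        ∫ u in 0..t, lam * Real.exp (-(α⁻¹ * (t - u))) * tail lam α u
      ≤ tail lam α t := by
  have hint := integral_mul_tail_nonneg (lam := lam) (α := α) ht
  rw [← ENNReal.ofReal_le_ofReal_iff (tail_nonneg t), ofReal_tail,
    ENNReal.ofReal_add (by positivity) (by positivity), ENNReal.ofReal_mul (by positivity),
    ← meanCyclePresent_eq_ofReal ht, ← expMeasure_Ioi Fact.out ht]
  exact le_cycleTail (expMeasure_Iic_zero Fact.out) exp_neg_mul_le_measure_present_eq_empty t

lemma bddAbove_image_tail (s : Set ℝ) : BddAbove (tail lam α '' s) :=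
  ⟨1, forall_mem_image.2 fun t _ ↦ tail_le_one t⟩

lemma bddBelow_image_tail (s : Set ℝ) : BddBelow (tail lam α '' s) :=
  ⟨0, forall_mem_image.2 fun t _ ↦ tail_nonneg t⟩

lemma tail_le_tailBound (hq : lam * α * (1 + 1) - 1 ≠ 0) {t : ℝ} (ht : 0 ≤ t) :
    tail lam α t ≤ tailBound lam α 1 t := by
  have hlam : 0 < lam := Fact.out
  have hα : 0 < α := Fact.out
  refine le_of_le_add_integral_of_add_integral_le (T := t)
    (k := fun v ↦ 1 * (lam * Real.exp (-(α⁻¹ * v)))) (h := fun t ↦ Real.exp (-(lam * t)))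
    (by fun_prop) (fun v _ ↦ by positivity)
    (intervalIntegrable_tail 0 t) (bddAbove_image_tail _)
    ((continuous_tailBound lam α 1).intervalIntegrable 0 t)
    (isCompact_Icc.bddBelow_image (continuous_tailBound lam α 1).continuousOn)
    (fun t ht ↦ ?_) (fun t _ ↦ (tailBound_eq hα.ne' hq t).ge) ⟨ht, le_rfl⟩
  simpa only [one_mul] using tail_le_add_integral ht.1

lemma tailBound_le_tail (hq : lam * α * (1 + Real.exp (-(lam * α))) - 1 ≠ 0) {t : ℝ}
    (ht : 0 ≤ t) : tailBound lam α (Real.exp (-(lam * α))) t ≤ tail lam α t := by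
  have hlam : 0 < lam := Fact.out
  have hα : 0 < α := Fact.out
  have hcont := continuous_tailBound lam α (Real.exp (-(lam * α)))
  refine le_of_le_add_integral_of_add_integral_le (T := t)
    (k := fun v ↦ Real.exp (-(lam * α)) * (lam * Real.exp (-(α⁻¹ * v))))
    (h := fun t ↦ Real.exp (-(lam * t))) (by fun_prop) (fun v _ ↦ by positivity)
    (hcont.intervalIntegrable 0 t) (isCompact_Icc.bddAbove_image hcont.continuousOn)
    (intervalIntegrable_tail 0 t) (bddBelow_image_tail _)
    (fun t _ ↦ (tailBound_eq hα.ne' hq t).le) (fun t ht ↦ ?_) ⟨ht, le_rfl⟩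
  simpa only [← intervalIntegral.integral_const_mul, mul_assoc] using add_integral_le_tail ht.1

end ExponentialService

section Queue

variable {Ω : Type*} [MeasurableSpace Ω] {P : Measure Ω} {lam α : ℝ} {A S : ℕ → Ω → ℝ}
  [Fact (0 < lam)] [Fact (0 < α)]

lemma IsQueue.hasLaw_path (hQ : IsQueue P lam α A S) :
    HasLaw (fun ω i ↦ Sum.elim A S i ω) (pathLaw (expMeasure lam) (expMeasure α⁻¹)) P := by
  have hlaw : ∀ i : ℕ ⊕ ℕ, HasLaw (Sum.elim A S i)
      (Sum.elim (fun _ ↦ expMeasure lam) (fun _ ↦ expMeasure α⁻¹) i : Measure ℝ) P :=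
    Sum.rec hQ.hasLaw_interarrival hQ.hasLaw_service
  exact hQ.indep.hasLaw_infinitePi hlaw (aemeasurable_pi_iff.2 fun i ↦ (hlaw i).aemeasurable)

lemma IsQueue.measureReal_busyCycle_le (hQ : IsQueue P lam α A S) (t : ℝ) :
    P.real {ω | busyCycle (fun n ↦ A n ω) (fun n ↦ S n ω) ≤ (t : EReal)} = 1 - tail lam α t := by
  have hpath := hQ.hasLaw_path
  have hU : MeasurableSet {x | Unfinished (interarrival x) (service x) t} :=
    measurableSet_unfinished (by fun_prop) (by fun_prop) measurable_const
  have hpos : ∀ᵐ x ∂pathLaw (expMeasure lam) (expMeasure α⁻¹),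
      (∀ n, 0 < interarrival x n) ∧ ∀ n, 0 < service x n :=
    (ae_interarrival_pos (expMeasure_Iic_zero Fact.out)).and
      (ae_service_pos (expMeasure_Iic_zero Fact.out))
  rw [tail, cycleTail, ← measureReal_def, ← probReal_compl_eq_one_sub hU, ← hpath.map_eq,
    map_measureReal_apply_of_aemeasurable hpath.aemeasurable hU.compl]
  rw [← hpath.map_eq] at hpos
  refine measureReal_congr ?_
  filter_upwards [ae_of_ae_map hpath.aemeasurable hpos] with ω hω
  exact propext (busyCycle_le_iff hω.1 (hω.2 0))

end Queue

end MMInfQueue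

theorem mainTheorem3 {Ω : Type*} [MeasurableSpace Ω] (P : Measure Ω) [IsProbabilityMeasure P]
    (lam α ρ : ℝ) (hlam : 0 < lam) (hα : 0 < α) (hρ : ρ = lam * α)
    (A S : ℕ → Ω → ℝ) (hQ : MMInfQueue.IsQueue P lam α A S) (t : ℝ) (ht : 0 ≤ t) :
    (2 * ρ - 1 ≠ 0 →
      1 - ((ρ - 1) * Real.exp (-lam * t) + ρ * Real.exp (-((1 - ρ) / α * t))) / (2 * ρ - 1)
        ≤ P.real {ω | MMInfQueue.busyCycle (fun n => A n ω) (fun n => S n ω) ≤ (t : EReal)}) ∧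
    (ρ * (1 + Real.exp (-ρ)) - 1 ≠ 0 →
      P.real {ω | MMInfQueue.busyCycle (fun n => A n ω) (fun n => S n ω) ≤ (t : EReal)}
        ≤ 1 - ((ρ - 1) * Real.exp (-lam * t)
              + ρ * Real.exp (-ρ - (1 - ρ * Real.exp (-ρ)) / α * t))
            / (ρ * (1 + Real.exp (-ρ)) - 1)) := by
  subst hρ
  have : Fact (0 < lam) := ⟨hlam⟩
  have : Fact (0 < α) := ⟨hα⟩
  rw [hQ.measureReal_busyCycle_le t]
  constructor
  · intro hq
    have hq' : lam * α * (1 + 1) - 1 ≠ 0 := by convert! hq using 1; ring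
    have upper := MMInfQueue.tail_le_tailBound hq' ht
    rw [MMInfQueue.tailBound] at upper
    convert sub_le_sub_left upper 1 using 3
    · rw [neg_mul, mul_one]
    · ring
  · intro hq
    have lower := MMInfQueue.tailBound_le_tail hq ht
    rw [MMInfQueue.tailBound] at lower
    rw [neg_mul, sub_eq_add_neg (-(lam * α)), Real.exp_add, ← mul_assoc]
    exact sub_le_sub_left lower 1
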